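/- **Setting.** Let $U$ be a finite ground set with $n$ elements and $M$ a matroid on $U$, with family $\mathcal F$ of independent sets (the feasible sets). Let $\mathsf C:\mathbb Z_{\ge 0}\to\mathbb Z_{\ge 0}$ be non-decreasing and convex with $\mathsf C(0)=0$. Each $e\in U$ has an integral value $v(e)$ and a positive integral size $s(e)$, and the densities $\rho(e)=v(e)/s(e)$ are pairwise distinct. Values and sizes extend additively to sets, and the profit of $A\subseteq U$ is $\pi(A)=v(A)-\mathsf C(s(A))$. Let $\mathbb I=\{e:\rho(e)\ge \mathsf C(s(e))-\mathsf C(s(e)-1)\}$ be the set of elements that it is best to accept whole rather than fractionally. For $T\subseteq U$ and a real $\gamma$ put $P^T_\gamma=\{e\in T:\rho(e)\ge\gamma\}$, $\bar P^T_\gamma=\{e\in T:\rho(e)>\gamma\}$ and $h_\gamma(A)=\sum_{e\in A}(\rho(e)-\gamma)s(e)$. The elements arrive in uniformly random order. An element reveals its data on arrival and is then irrevocably accepted or rejected; $U$, $\mathcal F$ and $\mathsf C$ are known in advance, and algorithms may be randomized. An algorithm that always outputs a feasible set is $\alpha$-competitive ($\alpha\ge1$) for $(\Phi,\mathcal F)$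 if $\alpha\cdot\mathbb E[\Phi(\text{output})]\ge\max_{S\in\mathcal F}\Phi(S)$ on all inputs. It is $\alpha$-competitive for the matroid secretary problem with a sum-of-values objective if this holds for every $\Phi(A)=\sum_{e\in A}w(e)$, where $w:U\to\mathbb R_{\ge0}$ and $w(e)$ is revealed when $e$ arrives. **Offline algorithm $\mathcal A$.** For $T\subseteq U$, $\mathcal A(T)$ is a most profitable set among: the sets $H_\gamma^T$ (a feasible subset of $\bar P_\gamma^T$ maximizing $h_\gamma$) and $G_\gamma^T$ (a feasible subset of $\bar P_\gamma^T$ of maximum total size), for the densities $\gamma$ of elements of $T$; the feasible single elements of $T$; and $\emptyset$. **Online algorithm (Algorithm 4).** Let a subroutine for the matroid secretary problem on $(U,\mathcal F)$ with a sum-of-values objective be given. 1. Draw $k\sim\mathrm{Binomial}(n,1/2)$. Reject the first $k$ elements; they form the sample $X$. Let $Y=U\setminus X$ be the remaining stream. Toss a fair coin. 2. If heads, accept only the first feasible single element of $Y$ whose profit is positive and higher than that of every feasible single element of $X$, ties being broken by density. 3. If tails, put $X'=X\cap\mathbb I$, $Y'=Y\cap\mathbb I$, $\beta=1/10$, and let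 $\tau$ be the highest density of an element of $X'$ such that $\pi(\mathcal A(P_\tau^{X'}))\ge\frac{\beta}{16}\pi(\mathcal A(X'))$. If $X'=\emptyset$, accept nothing. Otherwise toss another fair coin and run the subroutine on $P_\tau^{Y'}$, with objective $h_\tau$ if heads and with objective $s$ if tails. To run the subroutine on this part of the stream, the elements of $Y\setminus P_\tau^{Y'}$ are given to it with value $0$, and so are the elements of $X$, which are inserted at uniformly random positions. Go through the elements of $P_\tau^{Y'}$ accepted by the subroutine, as they are accepted, and add each one to the output $O$ if and only if $\pi(O\cup\{e\})\ge\pi(O)$. **Theorem.** There is an absolute constant $K>0$ such that for all $U$, $M$, $\mathsf C$ and $\alpha\ge1$ as above: if the subroutine is an $\alpha$-competitive online algorithm for the matroid secretary problem on $(U,\mathcal F)$ with a sum-of-values objective, then Algorithm 4 with this subroutine is an online algorithm that always outputs a feasible set and is $K\alpha$-competitive for $(\pi,\mathcal F)$, for all values and sizes as above. -/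

import Mathlib

open MeasureTheory

noncomputable section

namespace OnlineSelection

/-! ### Random-order online selection algorithms -/

/-- Arrival orders of a finite ground set: position `i` is occupied by the element `σ i`. -/
abbrev Order (U : Type) [Fintype U] : Type := Fin (Fintype.card U) ≃ U

instance orderMeasurableSpace (U : Type) [Fintype U] : MeasurableSpace (Order U) := ⊤

instance orderDiscrete (U : Type) [Fintype U] : DiscreteMeasurableSpace (Order U) :=
  ⟨fun _ => trivial⟩

instance orderNonempty (U : Type) [Fintype U] : Nonempty (Order U) :=
  ⟨(Fintype.equivFin U).symm⟩

/-- Histories are lists whose head is the most recent arrival. `picked p h` is the list of those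
members of `h` that were accepted at their arrival, when `p cur past` is the decision taken on the
arriving `cur` after the history `past`. -/
def picked {β : Type} (p : β → List β → Bool) : List β → List β
  | [] => []
  | cur :: past => if p cur past then cur :: picked p past else picked p past

/-- A randomized online algorithm on the ground set `U`, where every element reveals a datum in `D`
when it arrives. A seed is drawn in advance; the irrevocable decision on the arriving element
depends only on the seed, the element and its datum, and what has arrived before. -/
structure OnlineAlg (U D : Type) where
  Ω : Type
  [mΩ : MeasurableSpace Ω]
  μ : Measure Ω
  [prob : IsProbabilityMeasure μ]
  accept : Ω → U × D → List (U × D) → Bool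
  measurable_accept : ∀ cur past, Measurable fun ω => accept ω cur past

attribute [instance] OnlineAlg.mΩ OnlineAlg.prob

/-- Everything that arrives under the order `σ` with data `d`, most recent arrival first. -/
def fullHistory {U D : Type} [Fintype U] (σ : Order U) (d : U → D) : List (U × D) :=
  (List.ofFn fun i => (σ i, d (σ i))).reverse

namespace OnlineAlg

variable {U D : Type} [Fintype U] [DecidableEq U]

/-- The set of elements accepted with seed `ω`, arrival order `σ` and data `d`. -/
def output (A : OnlineAlg U D) (ω : A.Ω) (σ : Order U) (d : U → D) : Finset U :=
  ((picked (A.accept ω) (fullHistory σ d)).map Prod.fst).toFinset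

/-- The expected objective value, over a uniformly random order and the random seed. -/
def expected (A : OnlineAlg U D) (Φ : Finset U → ℝ) (d : U → D) : ℝ :=
  (∑ σ : Order U, ∫ ω, Φ (A.output ω σ d) ∂A.μ) / (Fintype.card (Order U) : ℝ)

/-- `A` is `α`-competitive for the objective `Φ` and the feasibility constraint `F`, on the inputs
in `Inst`: it always outputs a feasible set, and `α` times its expected objective value is at least
the objective value of every feasible set, hence at least the offline optimum. -/
def IsCompetitive (A : OnlineAlg U D) (Inst : Set (U → D)) (F : Finset U → Prop)
    (Φ : (U → D) → Finset U → ℝ) (α : ℝ) : Prop :=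
  ∀ d ∈ Inst, (∀ ω σ, F (A.output ω σ d)) ∧ ∀ S, F S → Φ d S ≤ α * A.expected (Φ d) d

end OnlineAlg

/-! ### Requests, cost and profit -/

/-- What an element reveals upon arrival. -/
structure Request where
  value : ℤ
  size : ℕ

/-- Value per unit of size. -/
def Request.density (r : Request) : ℝ := (r.value : ℝ) / (r.size : ℝ)

/-- A normalized non-decreasing convex cost function. -/
structure IsCost (C : ℕ → ℕ) : Prop where
  zero : C 0 = 0
  mono : Monotone C
  convex : ∀ t, 2 * C (t + 1) ≤ C t + C (t + 2)

/-- Sizes are positive and densities are pairwise distinct. -/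
structure IsInstance {U : Type} (d : U → Request) : Prop where
  size_pos : ∀ e, 0 < (d e).size
  density_injective : Function.Injective fun e => (d e).density

/-- The cost of the last unit of size `t` (used for positive `t` only). -/
def marginalCost (C : ℕ → ℕ) (t : ℕ) : ℝ := (C t : ℝ) - (C (t - 1) : ℝ)

/-- The requests that are best accepted whole rather than fractionally. -/
def Request.Whole (C : ℕ → ℕ) (r : Request) : Prop := marginalCost C r.size ≤ r.density

section Sets

variable {U : Type}

def totalSize (d : U → Request) (S : Finset U) : ℕ := ∑ e ∈ S, (d e).size

/-- Total value minus the cost of the total size. -/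
def profit (C : ℕ → ℕ) (d : U → Request) (S : Finset U) : ℝ :=
  (∑ e ∈ S, ((d e).value : ℝ)) - (C (totalSize d S) : ℝ)

/-- The sum-of-values objective in which `e` counts `(ρ(e) - γ) s(e)`. -/
def shiftedDensity (d : U → Request) (γ : ℝ) (S : Finset U) : ℝ :=
  ∑ e ∈ S, ((d e).density - γ) * ((d e).size : ℝ)

open scoped Classical in
/-- The elements of `T` of density at least `γ`. -/
def densityPrefix (d : U → Request) (γ : ℝ) (T : Finset U) : Finset U :=
  T.filter fun e => γ ≤ (d e).density

open scoped Classical in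
/-- The elements of `T` of density more than `γ`, that is, the prefix without the one element of
density `γ`. -/
def partialPrefix (d : U → Request) (γ : ℝ) (T : Finset U) : Finset U :=
  T.filter fun e => γ < (d e).density

/-! ### The offline algorithm -/

/-- A maximizer of `f` over a family of sets (the empty set if the family is empty). -/
def argmaxOver (𝒮 : Finset (Finset U)) (f : Finset U → ℝ) : Finset U :=
  if h : 𝒮.Nonempty then Classical.choose (𝒮.exists_max_image f h) else ∅

open scoped Classical in
/-- The independent subsets of `T`. -/
def indepSubsets (M : Matroid U) (T : Finset U) : Finset (Finset U) :=
  T.powerset.filter fun S => M.Indep (S : Set U)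

/-- A feasible subset of the density prefix maximizing the shifted density. The element of density
exactly `γ` contributes zero and is left out. -/
def bestShifted (M : Matroid U) (d : U → Request) (γ : ℝ) (T : Finset U) : Finset U :=
  argmaxOver (indepSubsets M (partialPrefix d γ T)) (shiftedDensity d γ)

/-- A feasible subset of the partial density prefix of maximum total size. -/
def bestSize (M : Matroid U) (d : U → Request) (γ : ℝ) (T : Finset U) : Finset U :=
  argmaxOver (indepSubsets M (partialPrefix d γ T)) fun S => (totalSize d S : ℝ)

open scoped Classical in
/-- The most profitable among: the two sets above, for the densities `γ` of the elements of `T`;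
the feasible single elements of `T`; and the empty set. -/
def offline (C : ℕ → ℕ) (M : Matroid U) (d : U → Request) (T : Finset U) : Finset U :=
  argmaxOver
    (insert ∅ (T.image (fun e => bestShifted M d (d e).density T)
      ∪ T.image (fun e => bestSize M d (d e).density T)
      ∪ (T.filter fun e => M.Indep {e}).image fun e => {e}))
    (profit C d)

/-- The constant of the algorithm. -/
def sampleConst : ℝ := 1 / 10

open scoped Classical in
/-- The highest density `γ` of an element of `T` such that the offline algorithm on the prefix of
`T` at `γ` makes at least a `sampleConst / 16` fraction of its profit on `T`; `none` if `T` is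
empty. -/
def threshold (C : ℕ → ℕ) (M : Matroid U) (d : U → Request) (T : Finset U) : Option ℝ :=
  let Γ := (T.image fun e => (d e).density).filter fun γ =>
    sampleConst / 16 * profit C d (offline C M d T)
      ≤ profit C d (offline C M d (densityPrefix d γ T))
  if h : Γ.Nonempty then some (Γ.max' h) else none

end Sets

/-! ### The online algorithm -/

section Online

variable {U : Type} [DecidableEq U]

/-- The requests as read off from a history. -/
def lookup (h : List (U × Request)) (e : U) : Request := (h.lookup e).getD ⟨0, 0⟩

/-- `e` is a feasible single element of positive profit, and its profit is higher than that of every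
feasible single element of `X`, ties being broken by density. -/
def Beats (C : ℕ → ℕ) (M : Matroid U) (d : U → Request) (X : Finset U) (e : U) : Prop :=
  M.Indep {e} ∧ 0 < profit C d {e} ∧ ∀ x ∈ X, M.Indep {x} →
    profit C d {x} < profit C d {e} ∨
      (profit C d {x} = profit C d {e} ∧ (d x).density < (d e).density)

/-- The stream (in chronological order) that is fed to a subroutine for the whole ground set when
it is run on a stream in which the elements of `X` are missing: the positions of the elements of `X`
in the order `θ` are filled by these elements, with value zero; the other positions are filled by
the actual arrivals. The result ends with the last actual arrival. -/
def interleave (X : Finset U) : List U → List (U × ℝ) → List (U × ℝ)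
  | _, [] => []
  | [], _ :: _ => []
  | u :: θ, a :: l =>
    if u ∈ X then (u, 0) :: interleave X θ (a :: l) else a :: interleave X θ l

/-- The decision of the subroutine with acceptance rule `acc` on the current arrival, when it is run
on the stream that follows the sample `X`; `w` is the sum-of-values objective, `θ` the order used
for the elements of `X`, and `past` what has arrived after the sample. -/
def subroutine (acc : U × ℝ → List (U × ℝ) → Bool) (θ : List U) (X : Finset U) (w : Request → ℝ)
    (cur : U × Request) (past : List (U × Request)) : Bool :=
  match (interleave X θ ((cur :: past).reverse.map fun a => (a.1, w a.2))).reverse with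
  | [] => false
  | a :: l => acc a l

/-- The requests on which the subroutines are run. -/
def Eligible (C : ℕ → ℕ) (τ : ℝ) (r : Request) : Prop := r.Whole C ∧ τ ≤ r.density

open scoped Classical in
/-- The values given to the subroutine: shifted densities (`b = true`) or sizes (`b = false`) of the
eligible requests; other requests are made worthless. -/
def subroutineValue (C : ℕ → ℕ) (τ : ℝ) (b : Bool) (r : Request) : ℝ :=
  if Eligible C τ r then
    (if b then (r.density - τ) * (r.size : ℝ) else (r.size : ℝ))
  else 0

open scoped Classical in
/-- Membership of the current arrival in the result of the subroutine, which is run on the eligible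
elements. -/
def inSubroutine (C : ℕ → ℕ) (τ : ℝ) (b : Bool) (acc : U × ℝ → List (U × ℝ) → Bool) (θ : List U)
    (X : Finset U) (cur : U × Request) (past : List (U × Request)) : Bool :=
  decide (Eligible C τ cur.2) && subroutine acc θ X (subroutineValue C τ b) cur past

open scoped Classical in
/-- Go through a list of elements, the last entry first, and keep an element if this does not
decrease the profit of what is kept. -/
def kept (C : ℕ → ℕ) (d : U → Request) : List U → Finset U
  | [] => ∅
  | e :: l =>
    if profit C d (kept C d l) ≤ profit C d (insert e (kept C d l)) then insert e (kept C d l)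
    else kept C d l

open scoped Classical in
/-- Run a subroutine on the stream after the sample `X`, with density threshold `τ`, and go through
its result as it is produced: accept the current arrival if the subroutine does and this does not
decrease the profit of what has been accepted. -/
def secondStage (C : ℕ → ℕ) (acc : U × ℝ → List (U × ℝ) → Bool) (τ : ℝ) (b : Bool) (θ : List U)
    (X : Finset U) (cur : U × Request) (past : List (U × Request)) : Bool :=
  let d := lookup (cur :: past)
  let O := kept C d ((picked (inSubroutine C τ b acc θ X) past).map Prod.fst)
  inSubroutine C τ b acc θ X cur past && decide (profit C d O ≤ profit C d (insert cur.1 O))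

section Measurability

variable {Ω : Type} [MeasurableSpace Ω]

theorem measurable_picked {β : Type} (p : Ω → β → List β → Bool)
    (hp : ∀ cur past, Measurable fun ω => p ω cur past) (h : List β) (g : List β → Bool) :
    Measurable fun ω => g (picked (p ω) h) := by
  induction h generalizing g with
  | nil => simpa only [picked] using measurable_const
  | cons cur past ih =>
    have hs : MeasurableSet {ω | p ω cur past = true} :=
      hp cur past (measurableSet_singleton true)
    have : Measurable fun ω =>
        if p ω cur past = true then g (cur :: picked (p ω) past) else g (picked (p ω) past) :=
      Measurable.ite hs (ih fun l => g (cur :: l)) (ih g)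
    simpa only [picked, apply_ite g] using this

theorem measurable_inSubroutine (C : ℕ → ℕ) (τ : ℝ) (b : Bool)
    (acc : Ω → U × ℝ → List (U × ℝ) → Bool)
    (hacc : ∀ cur past, Measurable fun ω => acc ω cur past) (θ : List U) (X : Finset U)
    (cur : U × Request) (past : List (U × Request)) :
    Measurable fun ω => inSubroutine C τ b (acc ω) θ X cur past := by
  have h : Measurable fun ω => subroutine (acc ω) θ X (subroutineValue C τ b) cur past := by
    unfold subroutine
    split
    · exact measurable_const
    · exact hacc _ _
  classical
  exact (measurable_of_countable fun x : Bool => decide (Eligible C τ cur.2) && x).comp h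

theorem measurable_secondStage (C : ℕ → ℕ) (acc : Ω → U × ℝ → List (U × ℝ) → Bool)
    (hacc : ∀ cur past, Measurable fun ω => acc ω cur past) (τ : ℝ) (b : Bool) (θ : List U)
    (X : Finset U) (cur : U × Request) (past : List (U × Request)) :
    Measurable fun ω => secondStage C (acc ω) τ b θ X cur past := by
  classical
  have h1 := measurable_inSubroutine C τ b acc hacc θ X
  have h2 := measurable_picked _ h1 past fun l =>
    decide (profit C (lookup (cur :: past)) (kept C (lookup (cur :: past)) (l.map Prod.fst))
      ≤ profit C (lookup (cur :: past))
        (insert cur.1 (kept C (lookup (cur :: past)) (l.map Prod.fst))))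
  convert (measurable_of_countable fun x : Bool × Bool => x.1 && x.2).comp
    ((h1 cur past).prodMk h2) using 1
  funext ω
  simp [secondStage]

end Measurability

variable [Fintype U]

/-- The coins of the online algorithm: the length of the sample, a coin for running the single
element algorithm, a coin for the choice of the subroutine, and an order for the missing elements
of the subroutine. -/
abbrev Coins (U : Type) [Fintype U] : Type := ℕ × Bool × Bool × Order U

def fairCoin : Measure Bool := (PMF.uniformOfFintype Bool).toMeasure

def randomOrder (U : Type) [Fintype U] [DecidableEq U] : Measure (Order U) :=
  (PMF.uniformOfFintype (Order U)).toMeasure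

instance : IsProbabilityMeasure fairCoin := by unfold fairCoin; infer_instance

instance : IsProbabilityMeasure (randomOrder U) := by unfold randomOrder; infer_instance

/-- Independent draws, the first one from the binomial distribution with parameters `|U|` and
`1/2`. -/
def coinLaw (U : Type) [Fintype U] [DecidableEq U] : Measure (Coins U) :=
  (ProbabilityTheory.binomial (Fintype.card U) ⟨1 / 2, by norm_num, by norm_num⟩).prod
    (fairCoin.prod (fairCoin.prod (randomOrder U)))

instance : IsProbabilityMeasure (coinLaw U) := by unfold coinLaw; infer_instance

open scoped Classical in
/-- The acceptance rule of the online algorithm for the profit objective. -/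
def profitAccept (C : ℕ → ℕ) (M : Matroid U) (acc : U × ℝ → List (U × ℝ) → Bool) (c : Coins U)
    (cur : U × Request) (past : List (U × Request)) : Bool :=
  let k := c.1
  -- the first `k` arrivals are the sample, and are rejected
  if past.length < k then false
  else
    let sample := past.drop (past.length - k)
    let rest := past.take (past.length - k)
    let X : Finset U := (sample.map Prod.fst).toFinset
    let d := lookup (cur :: past)
    if c.2.1 then
      -- take the first element after the sample that beats the sample
      decide (Beats C M d X cur.1 ∧ ∀ y ∈ rest, ¬ Beats C M d X y.1)
    else
      match threshold C M (lookup sample) (X.filter fun e => (lookup sample e).Whole C) with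
      | none => false
      | some τ => secondStage C acc τ c.2.2.1 (List.ofFn c.2.2.2) X cur rest

theorem measurable_profitAccept {Ω : Type} [MeasurableSpace Ω] (C : ℕ → ℕ) (M : Matroid U)
    (acc : Ω → U × ℝ → List (U × ℝ) → Bool)
    (hacc : ∀ cur past, Measurable fun ω => acc ω cur past)
    (cur : U × Request) (past : List (U × Request)) :
    Measurable fun x : Coins U × Ω => profitAccept C M (acc x.2) x.1 cur past := by
  refine measurable_from_prod_countable_right fun c => ?_
  by_cases h1 : past.length < c.1
  · have e : (fun ω => profitAccept C M (acc ω) c cur past) = fun _ => false := by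
      funext ω
      simp [profitAccept, h1]
    exact e ▸ measurable_const
  by_cases h2 : c.2.1 = true
  · have e : ∃ b, (fun ω => profitAccept C M (acc ω) c cur past) = fun _ => b := by
      simp only [profitAccept, h1, h2, if_true, if_false]
      exact ⟨_, rfl⟩
    obtain ⟨b, e⟩ := e
    exact e ▸ measurable_const
  · have e : ∃ (t : Option ℝ) (θ : List U) (X : Finset U) (rest : List (U × Request)),
        ∀ ω, profitAccept C M (acc ω) c cur past = match t with
          | none => false
          | some τ => secondStage C (acc ω) τ c.2.2.1 θ X cur rest :=
      ⟨_, _, _, _, fun ω => by simp only [profitAccept, h1, h2, if_false, Bool.false_eq_true]; rfl⟩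
    obtain ⟨t, θ, X, rest, e⟩ := e
    change Measurable fun ω => profitAccept C M (acc ω) c cur past
    rw [funext e]
    rcases t with _ | τ
    · exact measurable_const
    · exact measurable_secondStage C acc hacc _ _ _ _ _ _

/-- The online algorithm for the profit objective with cost function `C` and matroid `M`, with the
algorithm `A` for sum-of-values objectives as its subroutine. -/
def profitAlg (C : ℕ → ℕ) (M : Matroid U) (A : OnlineAlg U ℝ) : OnlineAlg U Request where
  Ω := Coins U × A.Ω
  μ := (coinLaw U).prod A.μ
  accept ω := profitAccept C M (A.accept ω.2) ω.1
  measurable_accept := measurable_profitAccept C M A.accept A.measurable_accept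

end Online

end OnlineSelection

end

noncomputable section

namespace OnlineSelection

/-! ### Convex costs -/

section Cost

variable {C : ℕ → ℕ}

/-! For every real γ the profit splits as π(A) = h_γ(A) + f_γ(s(A)) with f_γ(t) = γt − C(t)
(`IsInstance.profit_eq`). The first part is linear. The second is a concave function of the size
that vanishes at 0, increases while the marginal cost is at most γ and decreases afterwards. Each
argument picks the γ that suits it.

An optimal set has at most one element that is not whole, so the optimum is at most V + m, where V
is the optimum over whole elements and m bounds the profit of every feasible single element
(`profit_le_maxProfit_whole_add`). The single element branch pays for m: for a quarter of the
samples the best element is outside and the runner-up, if any, inside (`exists_single_bound`). What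
remains is the case where m is tiny compared to V.

In that case random halves are representative. Profit is subadditive, so an optimal set splits into
two parts worth a third each, and exchanging the sampled and the unsampled elements of one part
shows that a random half retains a sixth of the profit for three quarters of the samples
(`four_mul_card_bad_samples_le`). Hence for half of the samples both the sample and the dense part
of the remainder are valuable (`exists_good_samples`). The offline algorithm is a 3-approximation
(`maxProfit_le_offline`), so the threshold τ has two properties (`threshold_spec`): the sampled
elements of density at least τ are worth a constant fraction of the sample, and those strictly
denser than τ are worth little. The second property forces f_τ to reach a value of order V
(`exists_le_surplus`).

Filtering the result of the subroutine is then harmless: either everything is kept and f_τ is still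
increasing at its size, or the profit is within m of the maximum of f_τ (`kept_spec`). The
subroutine is competitive only for linear objectives, so this dichotomy is converted into multiples
of h_τ and of s that lie below the profit kept in every outcome (`exists_kept_bounds`). Filling the
missing positions with worthless sample elements presents the subroutine with an exactly uniform
order (`sum_align`), so its guarantee applies to both objectives (`le_sum_meanProfit`). -/

theorem marginalCost_succ (C : ℕ → ℕ) (t : ℕ) :
    marginalCost C (t + 1) = (C (t + 1) : ℝ) - C t := rfl

theorem marginalCost_zero (C : ℕ → ℕ) : marginalCost C 0 = 0 := by simp [marginalCost]

theorem IsCost.marginalCost_mono (hC : IsCost C) : Monotone (marginalCost C) := by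
  refine monotone_nat_of_le_succ fun n => ?_
  cases n with
  | zero =>
    rw [marginalCost_zero, marginalCost_succ, sub_nonneg]
    exact_mod_cast hC.mono (Nat.le_succ 0)
  | succ n =>
    have := hC.convex n
    have h : 2 * (C (n + 1) : ℝ) ≤ C n + C (n + 2) := by exact_mod_cast this
    rw [marginalCost_succ, marginalCost_succ]
    linarith

theorem IsCost.marginalCost_nonneg (hC : IsCost C) (t : ℕ) : 0 ≤ marginalCost C t :=
  marginalCost_zero C ▸ hC.marginalCost_mono (Nat.zero_le t)

theorem IsCost.cost_add_le (hC : IsCost C) (a m : ℕ) :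
    (C (a + m) : ℝ) ≤ C a + m * marginalCost C (a + m) := by
  induction m with
  | zero => simp
  | succ m ih =>
    have h1 : marginalCost C (a + m + 1) = (C (a + m + 1) : ℝ) - C (a + m) := rfl
    have h2 := hC.marginalCost_mono (Nat.le_succ (a + m))
    have h3 : (m : ℝ) * marginalCost C (a + m) ≤ m * marginalCost C (a + m + 1) :=
      mul_le_mul_of_nonneg_left h2 (Nat.cast_nonneg m)
    rw [← add_assoc]
    push_cast
    linarith

theorem IsCost.le_cost_add (hC : IsCost C) (a m : ℕ) :
    (C a : ℝ) + m * marginalCost C a ≤ C (a + m) := by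
  induction m with
  | zero => simp
  | succ m ih =>
    have h1 : marginalCost C (a + m + 1) = (C (a + m + 1) : ℝ) - C (a + m) := rfl
    have h2 : marginalCost C a ≤ marginalCost C (a + m + 1) :=
      hC.marginalCost_mono (by omega)
    rw [← add_assoc]
    push_cast
    linarith

theorem IsCost.superadditive (hC : IsCost C) (a b : ℕ) : (C a : ℝ) + C b ≤ C (a + b) := by
  induction b with
  | zero => simp [hC.zero]
  | succ b ih =>
    have h1 : marginalCost C (a + b + 1) = (C (a + b + 1) : ℝ) - C (a + b) := rfl
    have h3 : marginalCost C (b + 1) = (C (b + 1) : ℝ) - C b := rfl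
    have h2 : marginalCost C (b + 1) ≤ marginalCost C (a + b + 1) :=
      hC.marginalCost_mono (by omega)
    rw [← add_assoc]
    linarith

/-- What is gained by covering `t` units at cost `C t` if each unit is paid `γ`. -/
def surplus (C : ℕ → ℕ) (γ : ℝ) (t : ℕ) : ℝ := γ * t - C t

theorem IsCost.surplus_zero (hC : IsCost C) (γ : ℝ) : surplus C γ 0 = 0 := by
  simp [surplus, hC.zero]

theorem IsCost.surplus_le_of_marginalCost_le (hC : IsCost C) {γ : ℝ} {x b : ℕ} (hxb : x ≤ b)
    (hb : marginalCost C b ≤ γ) : surplus C γ x ≤ surplus C γ b := by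
  obtain ⟨m, rfl⟩ := Nat.exists_eq_add_of_le hxb
  have h1 := hC.cost_add_le x m
  have h2 : (m : ℝ) * marginalCost C (x + m) ≤ m * γ :=
    mul_le_mul_of_nonneg_left hb (Nat.cast_nonneg m)
  unfold surplus
  push_cast
  linarith

theorem IsCost.surplus_le_of_le_marginalCost (hC : IsCost C) {γ : ℝ} {x a : ℕ} (hax : a ≤ x)
    (ha : γ ≤ marginalCost C a) : surplus C γ x ≤ surplus C γ a := by
  obtain ⟨m, rfl⟩ := Nat.exists_eq_add_of_le hax
  have h1 := hC.le_cost_add a m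
  have h2 : (m : ℝ) * γ ≤ m * marginalCost C a :=
    mul_le_mul_of_nonneg_left ha (Nat.cast_nonneg m)
  unfold surplus
  push_cast
  linarith

theorem IsCost.surplus_nonneg (hC : IsCost C) {γ : ℝ} {b : ℕ} (hb : marginalCost C b ≤ γ) :
    0 ≤ surplus C γ b :=
  hC.surplus_zero γ ▸ hC.surplus_le_of_marginalCost_le (Nat.zero_le b) hb

theorem IsCost.surplus_add_le (hC : IsCost C) (γ : ℝ) (a b : ℕ) :
    surplus C γ (a + b) ≤ surplus C γ a + surplus C γ b := by
  have := hC.superadditive a b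
  unfold surplus
  push_cast
  linarith

/-- The surplus is subadditive and nondecreasing up to `a` and up to `b`. The last hypothesis says
that `a + b` either covers `x` or is already past the peak, where the surplus only decreases. -/
theorem IsCost.surplus_le_add (hC : IsCost C) {γ : ℝ} {a b x : ℕ} (ha : marginalCost C a ≤ γ)
    (hb : marginalCost C b ≤ γ) (hx : x ≤ a + b ∨ γ < marginalCost C (a + b)) :
    surplus C γ x ≤ surplus C γ a + surplus C γ b := by
  rcases le_total x (a + b) with h | h
  · rcases le_total x a with h' | h'
    · linarith [hC.surplus_le_of_marginalCost_le h' ha, hC.surplus_nonneg hb]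
    · obtain ⟨y, rfl⟩ := Nat.exists_eq_add_of_le h'
      linarith [hC.surplus_add_le γ a y,
        hC.surplus_le_of_marginalCost_le (show y ≤ b by omega) hb]
  · rcases hx with hx | hx
    · obtain rfl : x = a + b := le_antisymm hx h
      exact hC.surplus_add_le γ a b
    · exact (hC.surplus_le_of_le_marginalCost h hx.le).trans (hC.surplus_add_le γ a b)

/-- A concave function vanishing at 0 has nonincreasing average slope; the form without division
also covers `a = 0`. -/
theorem IsCost.mul_surplus_le (hC : IsCost C) (γ : ℝ) {a b : ℕ} (hab : a ≤ b) :
    (a : ℝ) * surplus C γ b ≤ b * surplus C γ a := by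
  obtain ⟨m, rfl⟩ := Nat.exists_eq_add_of_le hab
  have h1 := hC.cost_add_le 0 a
  have h2 := hC.le_cost_add a m
  simp only [hC.zero, zero_add, Nat.cast_zero] at h1
  have h3 := mul_le_mul_of_nonneg_left h1 (Nat.cast_nonneg (α := ℝ) m)
  have h4 := mul_le_mul_of_nonneg_left h2 (Nat.cast_nonneg (α := ℝ) a)
  unfold surplus
  push_cast
  nlinarith

end Cost

/-! ### Profits of sets -/

section Profit

variable {U : Type} {C : ℕ → ℕ} {d : U → Request}

theorem totalSize_union [DecidableEq U] (d : U → Request) {A B : Finset U} (h : Disjoint A B) :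
    totalSize d (A ∪ B) = totalSize d A + totalSize d B :=
  Finset.sum_union h

theorem totalSize_insert [DecidableEq U] (d : U → Request) {e : U} {A : Finset U} (h : e ∉ A) :
    totalSize d (insert e A) = (d e).size + totalSize d A :=
  Finset.sum_insert h

theorem profit_empty (hC : IsCost C) (d : U → Request) : profit C d ∅ = 0 := by
  simp [profit, totalSize, hC.zero]

theorem profit_congr {d d' : U → Request} {S : Finset U} (h : ∀ e ∈ S, d e = d' e) :
    profit C d S = profit C d' S := by
  have h1 : totalSize d S = totalSize d' S := Finset.sum_congr rfl fun e he => by rw [h e he]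
  have h2 : ∑ e ∈ S, ((d e).value : ℝ) = ∑ e ∈ S, ((d' e).value : ℝ) :=
    Finset.sum_congr rfl fun e he => by rw [h e he]
  rw [profit, profit, h1, h2]

theorem profit_union_le [DecidableEq U] (hC : IsCost C) {A B : Finset U} (h : Disjoint A B) :
    profit C d (A ∪ B) ≤ profit C d A + profit C d B := by
  have := hC.superadditive (totalSize d A) (totalSize d B)
  rw [profit, profit, profit, Finset.sum_union h, totalSize_union d h]
  linarith

theorem IsInstance.density_mul_size (hd : IsInstance d) (e : U) :
    (d e).density * (d e).size = (d e).value := by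
  have : ((d e).size : ℝ) ≠ 0 := by exact_mod_cast (hd.size_pos e).ne'
  rw [Request.density, div_mul_cancel₀ _ this]

/-- Paying γ per unit turns the profit into a linear excess plus the surplus of the total size.
Since γ is arbitrary, it can be set to a threshold density or to a marginal cost as needed. -/
theorem IsInstance.profit_eq (hd : IsInstance d) (γ : ℝ) (S : Finset U) :
    profit C d S = shiftedDensity d γ S + surplus C γ (totalSize d S) := by
  have h : shiftedDensity d γ S = ∑ e ∈ S, ((d e).value : ℝ) - γ * totalSize d S := by
    rw [shiftedDensity, totalSize, Nat.cast_sum, Finset.mul_sum, ← Finset.sum_sub_distrib]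
    exact Finset.sum_congr rfl fun e _ => by rw [sub_mul, hd.density_mul_size]
  rw [h, profit, surplus]
  ring

theorem shiftedDensity_shift (d : U → Request) (γ δ : ℝ) (S : Finset U) :
    shiftedDensity d γ S = shiftedDensity d δ S + (δ - γ) * totalSize d S := by
  rw [shiftedDensity, shiftedDensity, totalSize, Nat.cast_sum, Finset.mul_sum,
    ← Finset.sum_add_distrib]
  exact Finset.sum_congr rfl fun e _ => by ring

theorem shiftedDensity_nonneg {γ : ℝ} {S : Finset U} (h : ∀ e ∈ S, γ ≤ (d e).density) :
    0 ≤ shiftedDensity d γ S :=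
  Finset.sum_nonneg fun e he => mul_nonneg (sub_nonneg.2 (h e he)) (Nat.cast_nonneg _)

theorem shiftedDensity_le_of_subset {γ : ℝ} {A B : Finset U} (hAB : A ⊆ B)
    (h : ∀ e ∈ B, e ∉ A → (d e).density ≤ γ) :
    shiftedDensity d γ B ≤ shiftedDensity d γ A := by
  classical
  rw [← Finset.sdiff_union_of_subset hAB, shiftedDensity,
    Finset.sum_union Finset.sdiff_disjoint]
  refine add_le_of_nonpos_left (Finset.sum_nonpos fun e he => ?_)
  rw [Finset.mem_sdiff] at he
  exact mul_nonpos_of_nonpos_of_nonneg (sub_nonpos.2 (h e he.1 he.2)) (Nat.cast_nonneg _)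

theorem Request.Whole.density_nonneg (hC : IsCost C) {r : Request} (h : r.Whole C) :
    0 ≤ r.density :=
  (hC.marginalCost_nonneg _).trans h

theorem IsInstance.surplus_le_profit_singleton (hd : IsInstance d) {γ : ℝ} {e : U}
    (h : γ ≤ (d e).density) : surplus C γ (d e).size ≤ profit C d {e} := by
  rw [hd.profit_eq γ]
  simpa [totalSize] using shiftedDensity_nonneg (S := {e}) (by simpa using h)

theorem IsInstance.surplus_le_profit (hd : IsInstance d) {γ : ℝ} {S : Finset U}
    (h : ∀ e ∈ S, γ ≤ (d e).density) : surplus C γ (totalSize d S) ≤ profit C d S := by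
  rw [hd.profit_eq γ]
  exact le_add_of_nonneg_left (shiftedDensity_nonneg h)

/-! ### Maximal profits -/

theorem argmaxOver_mem {𝒮 : Finset (Finset U)} (h : 𝒮.Nonempty) (f : Finset U → ℝ) :
    argmaxOver 𝒮 f ∈ 𝒮 := by
  rw [argmaxOver, dif_pos h]
  exact (Classical.choose_spec (𝒮.exists_max_image f h)).1

theorem le_argmaxOver {𝒮 : Finset (Finset U)} (f : Finset U → ℝ) {S : Finset U} (h : S ∈ 𝒮) :
    f S ≤ f (argmaxOver 𝒮 f) := by
  rw [argmaxOver, dif_pos ⟨S, h⟩]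
  exact (Classical.choose_spec (𝒮.exists_max_image f ⟨S, h⟩)).2 S h

/-- Maximizers are picked by choice, so equal objective values alone would not give equal picks. The
picks agree because the predicates handed to choice are equal. This is what makes the offline
choices depend only on the data of the set they run on. -/
theorem argmaxOver_congr {𝒮 : Finset (Finset U)} {f g : Finset U → ℝ} (h : ∀ S ∈ 𝒮, f S = g S) :
    argmaxOver 𝒮 f = argmaxOver 𝒮 g := by
  by_cases hne : 𝒮.Nonempty
  · rw [argmaxOver, argmaxOver, dif_pos hne, dif_pos hne]
    congr 1
    funext x
    refine propext (and_congr_right fun hx => forall₂_congr fun y hy => ?_)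
    rw [h x hx, h y hy]
  · rw [argmaxOver, argmaxOver, dif_neg hne, dif_neg hne]

variable {M : Matroid U}

theorem mem_indepSubsets {T S : Finset U} :
    S ∈ indepSubsets M T ↔ S ⊆ T ∧ M.Indep (S : Set U) := by
  simp [indepSubsets]

theorem empty_mem_indepSubsets (M : Matroid U) (T : Finset U) : ∅ ∈ indepSubsets M T := by
  simp [mem_indepSubsets]

/-- The largest profit of an independent subset. -/
def maxProfit (C : ℕ → ℕ) (M : Matroid U) (d : U → Request) (T : Finset U) : ℝ :=
  profit C d (argmaxOver (indepSubsets M T) (profit C d))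

theorem profit_le_maxProfit {S T : Finset U} (hS : M.Indep (S : Set U)) (h : S ⊆ T) :
    profit C d S ≤ maxProfit C M d T :=
  le_argmaxOver (profit C d) (mem_indepSubsets.2 ⟨h, hS⟩)

theorem exists_profit_eq_maxProfit (C : ℕ → ℕ) (M : Matroid U) (d : U → Request) (T : Finset U) :
    ∃ S ⊆ T, M.Indep (S : Set U) ∧ profit C d S = maxProfit C M d T := by
  have h := mem_indepSubsets.1
    (argmaxOver_mem ⟨∅, empty_mem_indepSubsets M T⟩ (profit C d))
  exact ⟨_, h.1, h.2, rfl⟩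

theorem maxProfit_mono {S T : Finset U} (h : S ⊆ T) :
    maxProfit C M d S ≤ maxProfit C M d T := by
  obtain ⟨O, hO, hi, e⟩ := exists_profit_eq_maxProfit C M d S
  exact e ▸ profit_le_maxProfit hi (hO.trans h)

theorem maxProfit_nonneg (hC : IsCost C) (M : Matroid U) (d : U → Request) (T : Finset U) :
    0 ≤ maxProfit C M d T :=
  profit_empty hC d ▸ profit_le_maxProfit (by simp) (Finset.empty_subset T)

/-- The largest total size of an independent subset. -/
def maxSize (M : Matroid U) (d : U → Request) (T : Finset U) : ℕ :=
  totalSize d (argmaxOver (indepSubsets M T) fun S => (totalSize d S : ℝ))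

theorem totalSize_le_maxSize {S T : Finset U} (hS : M.Indep (S : Set U)) (h : S ⊆ T) :
    totalSize d S ≤ maxSize M d T := by
  exact_mod_cast le_argmaxOver (fun S => (totalSize d S : ℝ)) (mem_indepSubsets.2 ⟨h, hS⟩)

theorem exists_totalSize_eq_maxSize (M : Matroid U) (d : U → Request) (T : Finset U) :
    ∃ S ⊆ T, M.Indep (S : Set U) ∧ totalSize d S = maxSize M d T := by
  have h := mem_indepSubsets.1
    (argmaxOver_mem ⟨∅, empty_mem_indepSubsets M T⟩ fun S => (totalSize d S : ℝ))
  exact ⟨_, h.1, h.2, rfl⟩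

theorem maxSize_mono {S T : Finset U} (h : S ⊆ T) : maxSize M d S ≤ maxSize M d T := by
  obtain ⟨O, hO, hi, e⟩ := exists_totalSize_eq_maxSize M d S
  exact e ▸ totalSize_le_maxSize hi (hO.trans h)

theorem bestSize_spec (M : Matroid U) (d : U → Request) (γ : ℝ) (T : Finset U) :
    bestSize M d γ T ⊆ partialPrefix d γ T ∧ M.Indep (bestSize M d γ T : Set U) ∧
      totalSize d (bestSize M d γ T) = maxSize M d (partialPrefix d γ T) := by
  have h := mem_indepSubsets.1
    (argmaxOver_mem ⟨∅, empty_mem_indepSubsets M (partialPrefix d γ T)⟩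
      fun S => (totalSize d S : ℝ))
  exact ⟨h.1, h.2, rfl⟩

theorem bestShifted_spec (M : Matroid U) (d : U → Request) (γ : ℝ) (T : Finset U) :
    bestShifted M d γ T ⊆ partialPrefix d γ T ∧ M.Indep (bestShifted M d γ T : Set U) := by
  exact mem_indepSubsets.1
    (argmaxOver_mem ⟨∅, empty_mem_indepSubsets M (partialPrefix d γ T)⟩ (shiftedDensity d γ))

/-- The comparison set need not lie in the strict prefix: elements of density at most γ contribute
nonpositively and can be dropped. -/
theorem le_shiftedDensity_bestShifted {γ : ℝ} {S T : Finset U} (hS : M.Indep (S : Set U))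
    (h : S ⊆ T) : shiftedDensity d γ S ≤ shiftedDensity d γ (bestShifted M d γ T) := by
  classical
  have h1 : S.filter (fun e => γ < (d e).density) ⊆ S := Finset.filter_subset _ _
  refine (shiftedDensity_le_of_subset h1 fun e he he' => ?_).trans
    (le_argmaxOver (shiftedDensity d γ) (mem_indepSubsets.2 ⟨?_, hS.subset ?_⟩))
  · simpa [he] using he'
  · intro e he
    rw [Finset.mem_filter] at he
    simp [partialPrefix, he.2, h he.1]
  · exact_mod_cast h1

theorem mem_densityPrefix {γ : ℝ} {T : Finset U} {e : U} :
    e ∈ densityPrefix d γ T ↔ e ∈ T ∧ γ ≤ (d e).density := by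
  simp [densityPrefix]

theorem mem_partialPrefix {γ : ℝ} {T : Finset U} {e : U} :
    e ∈ partialPrefix d γ T ↔ e ∈ T ∧ γ < (d e).density := by
  simp [partialPrefix]

theorem densityPrefix_subset (d : U → Request) (γ : ℝ) (T : Finset U) :
    densityPrefix d γ T ⊆ T := fun _ he => (mem_densityPrefix.1 he).1

theorem partialPrefix_subset (d : U → Request) (γ : ℝ) (T : Finset U) :
    partialPrefix d γ T ⊆ T := fun _ he => (mem_partialPrefix.1 he).1

/-- The witness is the least dense element of the strict prefix. It turns a strict prefix into a
prefix at the density of an actual element, to which statements about such densities apply. -/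
theorem exists_densityPrefix_eq_partialPrefix {γ : ℝ} {T : Finset U}
    (h : (partialPrefix d γ T).Nonempty) :
    ∃ e ∈ T, γ < (d e).density ∧ densityPrefix d (d e).density T = partialPrefix d γ T := by
  obtain ⟨e, he, hmin⟩ := Finset.exists_min_image _ (fun e => (d e).density) h
  obtain ⟨heT, hlt⟩ := mem_partialPrefix.1 he
  refine ⟨e, heT, hlt, ?_⟩
  ext x
  rw [mem_densityPrefix, mem_partialPrefix]
  exact ⟨fun hx => ⟨hx.1, hlt.trans_le hx.2⟩, fun hx => ⟨hx.1, hmin x (mem_partialPrefix.2 hx)⟩⟩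

/-- Some set of maximal profit has at most one element that is not whole. -/
theorem profit_le_maxProfit_whole_add (hC : IsCost C) (hd : IsInstance d) {T W : Finset U} {m : ℝ}
    (hW : ∀ e ∈ T, (d e).Whole C → e ∈ W) (hm : 0 ≤ m)
    (hmax : ∀ e ∈ T, M.Indep {e} → profit C d {e} ≤ m) :
    maxProfit C M d T ≤ maxProfit C M d W + m := by
  classical
  obtain ⟨O, hOT, hO, hpi⟩ := exists_profit_eq_maxProfit C M d T
  rw [← hpi]
  -- Without `e` the total size is still at least that of `e`, because `e'` remains. So each unit of
  -- `e` costs at least the marginal cost at its own size, which exceeds its density, and removing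
  -- `e` would improve the optimum.
  have hremove : ∀ e ∈ O, ∀ e' ∈ O, e ≠ e' → ¬ (d e).Whole C → (d e).size ≤ (d e').size →
      False := by
    intro e he e' he' hne hnw hs
    have h1 : totalSize d O = (d e).size + totalSize d (O.erase e) :=
      (Finset.add_sum_erase O (fun e => (d e).size) he).symm
    have h2 : ∑ x ∈ O, ((d x).value : ℝ) = (d e).value + ∑ x ∈ O.erase e, ((d x).value : ℝ) :=
      (Finset.add_sum_erase O (fun e => ((d e).value : ℝ)) he).symm
    have h3 : (d e).size ≤ totalSize d (O.erase e) :=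
      hs.trans (Finset.single_le_sum (f := fun e => (d e).size) (fun _ _ => Nat.zero_le _)
        (Finset.mem_erase.2 ⟨hne.symm, he'⟩))
    have h4 := hC.le_cost_add (totalSize d (O.erase e)) (d e).size
    have h5 : ((d e).value : ℝ) < (d e).size * marginalCost C (totalSize d (O.erase e)) := by
      rw [← hd.density_mul_size, mul_comm]
      have : (0 : ℝ) < (d e).size := by exact_mod_cast hd.size_pos e
      exact mul_lt_mul_of_pos_left ((not_le.1 hnw).trans_le (hC.marginalCost_mono h3)) this
    have h6 : profit C d O < profit C d (O.erase e) := by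
      rw [profit, profit, h1, h2, add_comm (d e).size]
      linarith
    have h7 := profit_le_maxProfit (C := C) (d := d) (hO.subset (by simp))
      ((Finset.erase_subset e O).trans hOT)
    exact absurd h7 (not_le.2 (hpi ▸ h6))
  have hwhole : ∀ S ⊆ O, (∀ e ∈ S, (d e).Whole C) → profit C d S ≤ maxProfit C M d W :=
    fun S hS h => profit_le_maxProfit (hO.subset (by exact_mod_cast hS))
      fun e he => hW e (hOT (hS he)) (h e he)
  by_cases hall : ∀ e ∈ O, (d e).Whole C
  · exact (hwhole O subset_rfl hall).trans (le_add_of_nonneg_right hm)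
  · push Not at hall
    obtain ⟨e, he, hnw⟩ := hall
    have h1 : profit C d (O.erase e) ≤ maxProfit C M d W := by
      refine hwhole _ (Finset.erase_subset e O) fun e' he' => ?_
      rw [Finset.mem_erase] at he'
      by_contra hnw'
      rcases le_total (d e).size (d e').size with hs | hs
      · exact hremove e he e' he'.2 he'.1.symm hnw hs
      · exact hremove e' he'.2 e he he'.1 hnw' hs
    have h2 := profit_union_le (d := d) hC
      (show Disjoint (O.erase e) {e} by simp)
    rw [Finset.union_comm, ← Finset.insert_eq, Finset.insert_erase he] at h2
    linarith [hmax e (hOT he) (hO.subset (by simpa using he))]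

/-! ### The offline algorithm -/

open scoped Classical in
/-- The sets among which the offline algorithm chooses. -/
def candidates (M : Matroid U) (d : U → Request) (T : Finset U) : Finset (Finset U) :=
  insert ∅ (T.image (fun e => bestShifted M d (d e).density T)
    ∪ T.image (fun e => bestSize M d (d e).density T)
    ∪ (T.filter fun e => M.Indep {e}).image fun e => {e})

theorem offline_eq (C : ℕ → ℕ) (M : Matroid U) (d : U → Request) (T : Finset U) :
    offline C M d T = argmaxOver (candidates M d T) (profit C d) := rfl

theorem mem_candidates {T S : Finset U} :
    S ∈ candidates M d T ↔ S = ∅ ∨ (∃ e ∈ T, bestShifted M d (d e).density T = S) ∨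
      (∃ e ∈ T, bestSize M d (d e).density T = S) ∨ ∃ e ∈ T, M.Indep {e} ∧ {e} = S := by
  classical
  rw [candidates]
  simp only [Finset.mem_insert, Finset.mem_union, Finset.mem_image, Finset.mem_filter, and_assoc,
    or_assoc]

theorem candidates_nonempty (M : Matroid U) (d : U → Request) (T : Finset U) :
    (candidates M d T).Nonempty := ⟨∅, mem_candidates.2 (Or.inl rfl)⟩

theorem subset_of_mem_candidates {T S : Finset U} (h : S ∈ candidates M d T) :
    S ⊆ T ∧ M.Indep (S : Set U) := by
  rcases mem_candidates.1 h with rfl | ⟨e, _, rfl⟩ | ⟨e, _, rfl⟩ | ⟨e, he, hi, rfl⟩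
  · simp
  · exact ⟨(bestShifted_spec M d _ T).1.trans (partialPrefix_subset _ _ _),
      (bestShifted_spec M d _ T).2⟩
  · exact ⟨(bestSize_spec M d _ T).1.trans (partialPrefix_subset _ _ _),
      (bestSize_spec M d _ T).2.1⟩
  · exact ⟨Finset.singleton_subset_iff.2 he, by rwa [Finset.coe_singleton]⟩

theorem profit_offline_le (C : ℕ → ℕ) (M : Matroid U) (d : U → Request) (T : Finset U) :
    profit C d (offline C M d T) ≤ maxProfit C M d T := by
  have h := subset_of_mem_candidates
    (argmaxOver_mem (candidates_nonempty M d T) (profit C d))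
  exact profit_le_maxProfit h.2 h.1

theorem le_profit_offline {T S : Finset U} (h : S ∈ candidates M d T) :
    profit C d S ≤ profit C d (offline C M d T) :=
  le_argmaxOver (profit C d) h

theorem profit_offline_nonneg (hC : IsCost C) (M : Matroid U) (d : U → Request) (T : Finset U) :
    0 ≤ profit C d (offline C M d T) :=
  profit_empty hC d ▸ le_profit_offline (mem_candidates.2 (Or.inl rfl))

theorem bestShifted_congr {d d' : U → Request} {T : Finset U} (h : ∀ e ∈ T, d e = d' e) (γ : ℝ) :
    bestShifted M d γ T = bestShifted M d' γ T := by
  have hp : partialPrefix d γ T = partialPrefix d' γ T :=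
    Finset.filter_congr fun e he => by rw [h e he]
  rw [bestShifted, bestShifted, hp]
  refine argmaxOver_congr fun S hS => Finset.sum_congr rfl fun e he => ?_
  rw [h e (partialPrefix_subset _ _ _ ((mem_indepSubsets.1 hS).1 he))]

theorem bestSize_congr {d d' : U → Request} {T : Finset U} (h : ∀ e ∈ T, d e = d' e) (γ : ℝ) :
    bestSize M d γ T = bestSize M d' γ T := by
  have hp : partialPrefix d γ T = partialPrefix d' γ T :=
    Finset.filter_congr fun e he => by rw [h e he]
  rw [bestSize, bestSize, hp]
  refine argmaxOver_congr fun S hS => congrArg Nat.cast (Finset.sum_congr rfl fun e he => ?_)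
  rw [h e (partialPrefix_subset _ _ _ ((mem_indepSubsets.1 hS).1 he))]

theorem offline_congr {d d' : U → Request} {T : Finset U} (h : ∀ e ∈ T, d e = d' e) :
    offline C M d T = offline C M d' T := by
  have hc : candidates M d T = candidates M d' T := by
    ext S
    rw [mem_candidates, mem_candidates]
    refine or_congr Iff.rfl (or_congr (exists_congr fun e => and_congr_right fun he => ?_)
      (or_congr (exists_congr fun e => and_congr_right fun he => ?_) Iff.rfl))
    · rw [h e he, bestShifted_congr h]
    · rw [h e he, bestSize_congr h]
  rw [offline_eq, offline_eq, hc]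
  exact argmaxOver_congr fun S hS =>
    profit_congr fun e he => h e ((subset_of_mem_candidates hS).1 he)

/-- The online algorithm computes its threshold from requests read off the history, which agree with
the true data only on what has arrived. -/
theorem threshold_congr {d d' : U → Request} {T : Finset U} (h : ∀ e ∈ T, d e = d' e) :
    threshold C M d T = threshold C M d' T := by
  classical
  have h1 : profit C d (offline C M d T) = profit C d' (offline C M d' T) := by
    rw [← offline_congr h]
    exact profit_congr fun e he => h e ((subset_of_mem_candidates
      (argmaxOver_mem (candidates_nonempty M d T) (profit C d))).1 he)
  have h2 (γ : ℝ) : profit C d (offline C M d (densityPrefix d γ T)) =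
      profit C d' (offline C M d' (densityPrefix d' γ T)) := by
    have hp : densityPrefix d γ T = densityPrefix d' γ T :=
      Finset.filter_congr fun e he => by rw [h e he]
    have hP : ∀ e ∈ densityPrefix d' γ T, d e = d' e :=
      fun e he => h e (densityPrefix_subset _ _ _ he)
    rw [hp, ← offline_congr hP]
    exact profit_congr fun e he => hP e ((subset_of_mem_candidates
      (argmaxOver_mem (candidates_nonempty M d _) (profit C d))).1 he)
  have h3 : T.image (fun e => (d e).density) = T.image fun e => (d' e).density :=
    Finset.image_congr fun e he => by simp only [h e he]
  simp only [threshold, h1, h2, h3]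

/-- On whole requests, the offline algorithm is a `3`-approximation. -/
theorem maxProfit_le_offline (hC : IsCost C) (hd : IsInstance d) {T : Finset U}
    (hT : ∀ e ∈ T, (d e).Whole C) :
    maxProfit C M d T ≤ 3 * profit C d (offline C M d T) := by
  classical
  obtain ⟨O, hOT, hO, hpi⟩ := exists_profit_eq_maxProfit C M d T
  rw [← hpi]
  set R := profit C d (offline C M d T) with hR
  have hR0 : 0 ≤ R := profit_offline_nonneg hC M d T
  have hshift (e : U) (he : e ∈ T) : profit C d (bestShifted M d (d e).density T) ≤ R :=
    le_profit_offline (mem_candidates.2 (Or.inr (Or.inl ⟨e, he, rfl⟩)))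
  have hsize (e : U) (he : e ∈ T) : profit C d (bestSize M d (d e).density T) ≤ R :=
    le_profit_offline (mem_candidates.2 (Or.inr (Or.inr (Or.inl ⟨e, he, rfl⟩))))
  have hsingle (e : U) (he : e ∈ T) (hi : M.Indep {e}) : profit C d {e} ≤ R :=
    le_profit_offline (mem_candidates.2 (Or.inr (Or.inr (Or.inr ⟨e, he, hi, rfl⟩))))
  -- A shifted maximizer is profitable if the maximal size is below the threshold.
  have hshifted (e : U) (he : e ∈ T) {a : ℕ} (ha : marginalCost C a ≤ (d e).density)
      (hle : maxSize M d (partialPrefix d (d e).density T) ≤ a) :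
      shiftedDensity d (d e).density (bestShifted M d (d e).density T) ≤ R := by
    refine le_trans ?_ (hshift e he)
    rw [hd.profit_eq (d e).density (bestShifted M d (d e).density T)]
    have hs := bestShifted_spec M d (d e).density T
    exact le_add_of_nonneg_right (hC.surplus_nonneg ((hC.marginalCost_mono
      ((totalSize_le_maxSize hs.2 hs.1).trans hle)).trans ha))
  have hsized (e : U) (he : e ∈ T) (γ : ℝ)
      (hγ : ∀ x ∈ partialPrefix d (d e).density T, γ ≤ (d x).density) :
      surplus C γ (maxSize M d (partialPrefix d (d e).density T)) ≤ R := by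
    have hs := bestSize_spec M d (d e).density T
    rw [← hs.2.2]
    exact (hd.surplus_le_profit fun x hx => hγ x (hs.1 hx)).trans (hsize e he)
  rcases T.eq_empty_or_nonempty with rfl | hne
  · obtain rfl := Finset.subset_empty.1 hOT
    rw [profit_empty hC]
    positivity
  -- The densest request whose prefix allows too large sets, or else the last request.
  obtain ⟨e, he, hbad, hgood⟩ : ∃ e ∈ T, (T ⊆ densityPrefix d (d e).density T ∨
      (d e).density < marginalCost C (maxSize M d (densityPrefix d (d e).density T))) ∧
      ∀ x ∈ T, (d e).density < (d x).density →
        marginalCost C (maxSize M d (densityPrefix d (d x).density T)) ≤ (d x).density := by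
    set B := T.filter fun e =>
      (d e).density < marginalCost C (maxSize M d (densityPrefix d (d e).density T)) with hB
    rcases B.eq_empty_or_nonempty with hBe | hBne
    · obtain ⟨e, he, hmin⟩ := Finset.exists_min_image T (fun e => (d e).density) hne
      refine ⟨e, he, Or.inl fun x hx => mem_densityPrefix.2 ⟨hx, hmin x hx⟩, fun x hx _ => ?_⟩
      by_contra hcon
      have hxB : x ∈ B := Finset.mem_filter.2 ⟨hx, not_le.1 hcon⟩
      rw [hBe] at hxB
      exact absurd hxB (Finset.notMem_empty x)
    · obtain ⟨e, he, hmax⟩ := Finset.exists_max_image B (fun e => (d e).density) hBne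
      rw [hB, Finset.mem_filter] at he
      refine ⟨e, he.1, Or.inr he.2, fun x hx hlt => ?_⟩
      by_contra hcon
      exact absurd (hmax x (Finset.mem_filter.2 ⟨hx, not_le.1 hcon⟩)) (not_le.2 hlt)
  set γ := (d e).density with hγ
  set a := maxSize M d (partialPrefix d γ T) with ha
  -- If size `a` is still affordable at γ, the optimum splits into three parts worth at most `R`
  -- each: its excess over γ, the surplus of `a`, and the surplus of `b`. Here `b` is the size of
  -- `e`, or 0 if a largest independent set of the prefix avoids `e`.
  by_cases hcase : marginalCost C a ≤ γ
  · obtain ⟨b, hb, hbR, hab⟩ : ∃ b, marginalCost C b ≤ γ ∧ surplus C γ b ≤ R ∧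
        maxSize M d (densityPrefix d γ T) ≤ a + b := by
      obtain ⟨S, hS, hSi, hSs⟩ := exists_totalSize_eq_maxSize M d (densityPrefix d γ T)
      have hsub : S.erase e ⊆ partialPrefix d γ T := by
        intro x hx
        rw [Finset.mem_erase] at hx
        obtain ⟨hxT, hle⟩ := mem_densityPrefix.1 (hS hx.2)
        exact mem_partialPrefix.2 ⟨hxT, lt_of_le_of_ne hle fun h =>
          hx.1 (hd.density_injective h.symm)⟩
      have hle : totalSize d (S.erase e) ≤ a :=
        totalSize_le_maxSize (hSi.subset (by simp)) hsub
      by_cases heS : e ∈ S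
      · have hei : M.Indep {e} := hSi.subset (by simpa using heS)
        refine ⟨(d e).size, hT e he, (hd.surplus_le_profit_singleton le_rfl).trans
          (hsingle e he hei), ?_⟩
        rw [← hSs, totalSize, ← Finset.sum_erase_add S _ heS]
        exact Nat.add_le_add_right hle _
      · refine ⟨0, ?_, by rw [hC.surplus_zero]; exact hR0, ?_⟩
        · rw [marginalCost_zero]
          exact (hT e he).density_nonneg hC
        · rw [Finset.erase_eq_of_notMem heS] at hle
          omega
    have h1 : surplus C γ (totalSize d O) ≤ surplus C γ a + surplus C γ b := by
      refine hC.surplus_le_add hcase hb (hbad.imp (fun h => ?_) fun h => ?_)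
      · exact (totalSize_le_maxSize hO (hOT.trans h)).trans hab
      · exact h.trans_le (hC.marginalCost_mono hab)
    have h2 := hsized e he γ fun x hx => (mem_partialPrefix.1 hx).2.le
    have h3 := hshifted e he hcase le_rfl
    have h4 := le_shiftedDensity_bestShifted (d := d) (γ := γ) hO hOT
    rw [hd.profit_eq γ]
    linarith
  -- Now the budget runs out between γ and the next higher density δ, so the marginal cost `g` at
  -- `a` lies between them. At `g` the surplus peaks exactly at `a`. Moving the shift from `g` to δ
  -- costs at most (δ − g)a, which turns the surplus of `a` at `g` into that at δ. Two candidates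
  -- suffice here.
  · rw [not_le] at hcase
    have hγ0 : 0 ≤ γ := (hT e he).density_nonneg hC
    have hPne : (partialPrefix d γ T).Nonempty := by
      by_contra hcon
      rw [Finset.not_nonempty_iff_eq_empty] at hcon
      obtain ⟨S, hS, -, hSs⟩ := exists_totalSize_eq_maxSize M d (partialPrefix d γ T)
      rw [hcon, Finset.subset_empty] at hS
      rw [ha, ← hSs, hS] at hcase
      simp only [totalSize, Finset.sum_empty, marginalCost_zero] at hcase
      linarith
    obtain ⟨x, hx, hlt, hxP⟩ := exists_densityPrefix_eq_partialPrefix hPne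
    have hgx := hgood x hx hlt
    rw [hxP, ← ha] at hgx
    set δ := (d x).density with hδ
    set g := marginalCost C a with hg
    set O' := O.filter fun y => γ < (d y).density with hO'
    have hO'O : O' ⊆ O := Finset.filter_subset _ _
    have hO'i : M.Indep (O' : Set U) := hO.subset (by exact_mod_cast hO'O)
    have hO'P : O' ⊆ partialPrefix d γ T := fun y hy => by
      rw [hO', Finset.mem_filter] at hy
      exact mem_partialPrefix.2 ⟨hOT hy.1, hy.2⟩
    have h1 : surplus C g (totalSize d O) ≤ surplus C g a := by
      rcases le_total (totalSize d O) a with h | h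
      · exact hC.surplus_le_of_marginalCost_le h le_rfl
      · exact hC.surplus_le_of_le_marginalCost h le_rfl
    have h2 : shiftedDensity d g O ≤ shiftedDensity d g O' := by
      refine shiftedDensity_le_of_subset hO'O fun y hy hy' => ?_
      have : ¬ γ < (d y).density := by simpa [hO', hy] using hy'
      linarith
    have h3 := shiftedDensity_shift d g δ O'
    have h4 : (δ - g) * totalSize d O' ≤ (δ - g) * a :=
      mul_le_mul_of_nonneg_left (by exact_mod_cast totalSize_le_maxSize hO'i hO'P)
        (sub_nonneg.2 hgx)
    have h5 := le_shiftedDensity_bestShifted (d := d) (γ := δ) hO'i (hO'O.trans hOT)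
    have h6 := hshifted x hx hgx (maxSize_mono fun y hy => by
      rw [mem_partialPrefix] at hy ⊢
      exact ⟨hy.1, hlt.trans hy.2⟩)
    have h7 := hsized e he δ fun y hy => by
      rw [← hγ, ← hxP] at hy
      exact (mem_densityPrefix.1 hy).2
    rw [← hγ, ← ha] at h7
    rw [hd.profit_eq g]
    simp only [surplus] at h1 h7 ⊢
    nlinarith

end Profit

/-! ### The threshold -/

section Threshold

variable {U : Type} {C : ℕ → ℕ} {d : U → Request} {M : Matroid U}

theorem threshold_spec (hC : IsCost C) (hd : IsInstance d) {T : Finset U}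
    (hT : ∀ e ∈ T, (d e).Whole C) (hne : T.Nonempty) :
    ∃ τ, threshold C M d T = some τ ∧ 0 ≤ τ ∧
      maxProfit C M d T ≤ 480 * maxProfit C M d (densityPrefix d τ T) ∧
      160 * maxProfit C M d (partialPrefix d τ T) ≤ 3 * maxProfit C M d T := by
  classical
  set Γ := (T.image fun e => (d e).density).filter fun γ =>
    sampleConst / 16 * profit C d (offline C M d T)
      ≤ profit C d (offline C M d (densityPrefix d γ T)) with hΓ
  have hmem (γ : ℝ) : γ ∈ Γ ↔ (∃ e ∈ T, (d e).density = γ) ∧ sampleConst / 16 *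
      profit C d (offline C M d T) ≤ profit C d (offline C M d (densityPrefix d γ T)) := by
    simp [hΓ]
  have hΓne : Γ.Nonempty := by
    obtain ⟨e, he, hmin⟩ := Finset.exists_min_image T (fun e => (d e).density) hne
    refine ⟨(d e).density, (hmem _).2 ⟨⟨e, he, rfl⟩, ?_⟩⟩
    have : densityPrefix d (d e).density T = T :=
      (densityPrefix_subset _ _ _).antisymm fun x hx => mem_densityPrefix.2 ⟨hx, hmin x hx⟩
    rw [this, sampleConst]
    linarith [profit_offline_nonneg hC M d T]
  have heq : threshold C M d T = some (Γ.max' hΓne) := by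
    rw [threshold]
    exact dif_pos hΓne
  obtain ⟨⟨e, he, hde⟩, hle⟩ := (hmem _).1 (Γ.max'_mem hΓne)
  refine ⟨Γ.max' hΓne, heq, hde ▸ (hT e he).density_nonneg hC, ?_, ?_⟩
  -- The test asks for a fraction 1/160 of the offline profit, and passing from offline profit to
  -- optimum costs a factor 3: 480 = 3 · 160.
  · have h1 := maxProfit_le_offline (M := M) hC hd hT
    have h2 := profit_offline_le C M d (densityPrefix d (Γ.max' hΓne) T)
    rw [sampleConst] at hle
    linarith
  · rcases (partialPrefix d (Γ.max' hΓne) T).eq_empty_or_nonempty with h | h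
    · obtain ⟨S, hS, -, hSe⟩ := exists_profit_eq_maxProfit C M d
        (partialPrefix d (Γ.max' hΓne) T)
      rw [h, Finset.subset_empty] at hS
      rw [← hSe, hS, profit_empty hC]
      linarith [maxProfit_nonneg hC M d T]
    -- The strict prefix is the prefix at the next higher density, which failed the test by
    -- maximality of the threshold.
    · obtain ⟨x, hx, hlt, hxP⟩ := exists_densityPrefix_eq_partialPrefix h
      have hnot : (d x).density ∉ Γ := fun hcon => absurd (Γ.le_max' _ hcon) (not_le.2 hlt)
      rw [hmem, not_and, not_le, hxP, sampleConst] at hnot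
      have h1 := hnot ⟨x, hx, rfl⟩
      have h2 := maxProfit_le_offline (M := M) hC hd fun y hy =>
        hT y (partialPrefix_subset d (Γ.max' hΓne) T hy)
      have h3 := profit_offline_le C M d T
      linarith

/-- The requests of density at most `τ` contribute at most a surplus at `τ`. -/
theorem exists_le_surplus (hC : IsCost C) (hd : IsInstance d) (M : Matroid U) (T : Finset U)
    (τ : ℝ) : ∃ x, maxProfit C M d T ≤ maxProfit C M d (partialPrefix d τ T) + surplus C τ x := by
  classical
  obtain ⟨O, hOT, hO, hpi⟩ := exists_profit_eq_maxProfit C M d T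
  set A := O.filter fun e => τ < (d e).density with hA
  have hAO : A ⊆ O := Finset.filter_subset _ _
  refine ⟨totalSize d (O \ A), ?_⟩
  have h1 : profit C d A ≤ maxProfit C M d (partialPrefix d τ T) := by
    refine profit_le_maxProfit (hO.subset (by exact_mod_cast hAO)) fun e he => ?_
    rw [hA, Finset.mem_filter] at he
    exact mem_partialPrefix.2 ⟨hOT he.1, he.2⟩
  have h2 := profit_union_le (d := d) hC (Finset.disjoint_sdiff : Disjoint A (O \ A))
  rw [Finset.union_sdiff_of_subset hAO, hpi, hd.profit_eq τ (O \ A)] at h2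
  have h3 : shiftedDensity d τ (O \ A) ≤ 0 := by
    refine Finset.sum_nonpos fun e he => ?_
    rw [Finset.mem_sdiff] at he
    have : ¬ τ < (d e).density := fun h => he.2 (Finset.mem_filter.2 ⟨he.1, h⟩)
    exact mul_nonpos_of_nonpos_of_nonneg (by linarith) (Nat.cast_nonneg _)
  linarith

end Threshold

/-! ### Keeping profitable elements -/

section Kept

variable {U : Type} [DecidableEq U] {C : ℕ → ℕ} {d : U → Request}

theorem kept_cons (C : ℕ → ℕ) (d : U → Request) (e : U) (l : List U) :
    kept C d (e :: l) =
      open scoped Classical in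
      if profit C d (kept C d l) ≤ profit C d (insert e (kept C d l)) then insert e (kept C d l)
      else kept C d l := rfl

theorem kept_subset (C : ℕ → ℕ) (d : U → Request) (l : List U) :
    kept C d l ⊆ l.toFinset := by
  induction l with
  | nil => simp [kept]
  | cons e l ih =>
    rw [kept_cons, List.toFinset_cons]
    split_ifs
    · exact Finset.insert_subset_insert _ ih
    · exact ih.trans (Finset.subset_insert _ _)

theorem kept_congr {d d' : U → Request} {l : List U} (h : ∀ e ∈ l, d e = d' e) :
    kept C d l = kept C d' l := by
  induction l with
  | nil => rfl
  | cons e l ih =>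
    have ih := ih fun x hx => h x (List.mem_cons_of_mem e hx)
    have h1 : ∀ x ∈ insert e (kept C d l), d x = d' x := by
      intro x hx
      rw [Finset.mem_insert] at hx
      rcases hx with rfl | hx
      · exact h x List.mem_cons_self
      · exact h x (List.mem_cons_of_mem e (List.mem_toFinset.1 (kept_subset C d l hx)))
    have h2 := profit_congr (C := C) h1
    have h3 := profit_congr (C := C) fun x hx =>
      h1 x (Finset.mem_insert_of_mem (a := x) (s := kept C d l) hx)
    rw [kept_cons, kept_cons, ← ih, h2, h3]

theorem profit_kept_le_cons (C : ℕ → ℕ) (d : U → Request) (e : U) (l : List U) :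
    profit C d (kept C d l) ≤ profit C d (kept C d (e :: l)) := by
  rw [kept_cons]
  split_ifs with h
  · exact h
  · exact le_rfl

theorem profit_kept_nonneg (hC : IsCost C) (d : U → Request) (l : List U) :
    0 ≤ profit C d (kept C d l) := by
  induction l with
  | nil => exact (profit_empty hC d).ge
  | cons e l ih => exact ih.trans (profit_kept_le_cons C d e l)

/-- Either everything is kept and the total size is small, or what is kept is nearly as profitable
as the density `τ` allows. -/
theorem kept_spec (hC : IsCost C) (hd : IsInstance d) {τ m : ℝ} (hτ : 0 ≤ τ) {l : List U}
    (hl : l.Nodup) (hlτ : ∀ e ∈ l, Eligible C τ (d e)) (hm : ∀ e ∈ l, profit C d {e} ≤ m) :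
    (kept C d l = l.toFinset ∧ marginalCost C (totalSize d l.toFinset) ≤ τ) ∨
      ∀ x, surplus C τ x ≤ profit C d (kept C d l) + m := by
  induction l with
  | nil => exact Or.inl ⟨rfl, by simpa [totalSize, marginalCost_zero] using hτ⟩
  | cons e l ih =>
    rw [List.nodup_cons] at hl
    obtain ⟨hwhole, hdens⟩ := hlτ e List.mem_cons_self
    have hme := hm e List.mem_cons_self
    have hstep := profit_kept_le_cons C d e l
    have hel : e ∉ l.toFinset := by simpa using hl.1
    rcases ih hl.2 (fun x hx => hlτ x (List.mem_cons_of_mem e hx))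
      (fun x hx => hm x (List.mem_cons_of_mem e hx)) with ⟨hall, hsmall⟩ | h
    · set a := totalSize d l.toFinset with ha
      have hfa : surplus C τ a ≤ profit C d (kept C d l) := by
        rw [hall]
        exact hd.surplus_le_profit fun x hx =>
          (hlτ x (List.mem_cons_of_mem e (List.mem_toFinset.1 hx))).2
      -- As long as the marginal cost stays at most τ, every unit of a new eligible element pays for
      -- itself, so the element is kept. The first overflow is the only place where work is needed;
      -- afterwards the profit kept never decreases.
      by_cases hbig : marginalCost C (a + (d e).size) ≤ τ
      · left
        have hkept : kept C d (e :: l) = (e :: l).toFinset := by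
          rw [kept_cons, hall, if_pos, List.toFinset_cons]
          rw [profit, profit, Finset.sum_insert hel, totalSize_insert d hel, ← ha,
            add_comm (d e).size]
          have h1 := hC.cost_add_le a (d e).size
          have h2 : ((d e).size : ℝ) * marginalCost C (a + (d e).size) ≤
              (d e).size * (d e).density :=
            mul_le_mul_of_nonneg_left (hbig.trans hdens) (Nat.cast_nonneg _)
          rw [mul_comm _ (d e).density, hd.density_mul_size] at h2
          linarith
        refine ⟨hkept, ?_⟩
        rwa [List.toFinset_cons, totalSize_insert d hel, ← ha, add_comm]
      · right
        intro x
        -- At an overflow the previous size and the size of `e` together pass the peak of the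
        -- surplus at τ, so the two surpluses bound it. If `e` alone is past the peak, its own
        -- profit bounds the surplus: below its size by wholeness, above it because the surplus
        -- decreases.
        by_cases hse : marginalCost C (d e).size ≤ τ
        · have h1 := hC.surplus_le_add (x := x) hsmall hse (Or.inr (not_le.1 hbig))
          have h2 := hd.surplus_le_profit_singleton (C := C) hdens
          linarith
        · have h1 : surplus C τ x ≤ profit C d {e} := by
            have h2 := hd.surplus_le_profit_singleton (C := C) (le_refl (d e).density)
            rcases le_total x (d e).size with hx | hx
            · have h3 := hC.surplus_le_of_marginalCost_le hx hwhole
              have h4 : τ * x ≤ (d e).density * x :=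
                mul_le_mul_of_nonneg_right hdens (Nat.cast_nonneg x)
              rw [surplus] at h3 ⊢
              linarith
            · exact (hC.surplus_le_of_le_marginalCost hx (not_le.1 hse).le).trans
                (hd.surplus_le_profit_singleton hdens)
          linarith [profit_kept_nonneg hC d (e :: l)]
    · exact Or.inr fun x => (h x).trans (by linarith)

variable {M : Matroid U}

/-- The profit of what is kept is linearly bounded below, both in terms of the shifted densities
and in terms of the sizes. -/
theorem exists_kept_bounds (hC : IsCost C) (hd : IsInstance d) {τ m : ℝ} (hτ : 0 ≤ τ) (hm0 : 0 ≤ m)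
    {P : Finset U} (hP : ∀ e ∈ P, Eligible C τ (d e))
    (hm : ∀ e ∈ P, M.Indep {e} → profit C d {e} ≤ m)
    (x₁ : ℕ) :
    ∃ S₁ ⊆ P, M.Indep (S₁ : Set U) ∧ ∃ S₂ ⊆ P, M.Indep (S₂ : Set U) ∧
      ∃ c₁ ≥ 0, ∃ c₂ ≥ 0,
        (∀ l : List U, l.Nodup → l.toFinset ⊆ P → M.Indep (l.toFinset : Set U) →
          c₁ * shiftedDensity d τ l.toFinset ≤ profit C d (kept C d l) ∧
          c₂ * totalSize d l.toFinset ≤ profit C d (kept C d l)) ∧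
        min (maxProfit C M d P) (surplus C τ x₁) - m ≤
          c₁ * shiftedDensity d τ S₁ + c₂ * totalSize d S₂ := by
  obtain ⟨S₁, hS₁, hS₁max⟩ := (indepSubsets M P).exists_max_image (shiftedDensity d τ)
    ⟨∅, empty_mem_indepSubsets M P⟩
  obtain ⟨S₂, hS₂P, hS₂, hS₂max⟩ := exists_totalSize_eq_maxSize M d P
  obtain ⟨O, hOP, hO, hOpi⟩ := exists_profit_eq_maxProfit C M d P
  rw [mem_indepSubsets] at hS₁
  set H := shiftedDensity d τ S₁ with hH
  set S : ℝ := (totalSize d S₂ : ℝ) with hS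
  set F := surplus C τ x₁ with hF
  set x₀ := totalSize d O with hx₀
  set f₀ := surplus C τ x₀ with hf₀
  have hH0 : 0 ≤ H := shiftedDensity_nonneg fun e he => (hP e (hS₁.1 he)).2
  have hS0 : 0 ≤ S := Nat.cast_nonneg _
  have hx₀S : (x₀ : ℝ) ≤ S := by
    rw [hS, hS₂max]
    exact_mod_cast totalSize_le_maxSize hO hOP
  have hsum : maxProfit C M d P ≤ H + f₀ := by
    rw [← hOpi, hd.profit_eq τ]
    have := hS₁max O (mem_indepSubsets.2 ⟨hOP, hO⟩)
    linarith
  -- The slopes are `b₁ / H` and `b₂ / S`. When everything is kept, the first bound needs `b₁ ≤ H`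
  -- and the second uses concavity between 0 and `x₀`. After an overflow, the caps `F - m` and `f₀ -
  -- m` are what the filter guarantees. If `H` or `S` is 0, the corresponding `b` is 0 as well, so
  -- division by zero is harmless.
  set b₁ := max 0 (min H (F - m)) with hb₁
  set b₂ := max 0 (f₀ - m) with hb₂
  have hb₁0 : 0 ≤ b₁ := le_max_left _ _
  have hb₂0 : 0 ≤ b₂ := le_max_left _ _
  have hb₁H : b₁ ≤ H := max_le hH0 (min_le_left _ _)
  have hc₁ : b₁ / H * H = b₁ := div_mul_cancel_of_imp fun h => le_antisymm (h ▸ hb₁H) hb₁0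
  have hc₂ : b₂ / S * S = b₂ := by
    refine div_mul_cancel_of_imp fun h => ?_
    have hx : x₀ = 0 := by
      rw [h] at hx₀S
      exact_mod_cast le_antisymm hx₀S (Nat.cast_nonneg _)
    have : f₀ = 0 := by rw [hf₀, hx, hC.surplus_zero]
    rw [hb₂, this]
    exact max_eq_left (by linarith)
  refine ⟨S₁, hS₁.1, hS₁.2, S₂, hS₂P, hS₂, b₁ / H, by positivity, b₂ / S, by positivity, ?_, ?_⟩
  · intro l hl hlP hli
    have hkept0 := profit_kept_nonneg hC d l
    have hlH : shiftedDensity d τ l.toFinset ≤ H :=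
      hS₁max _ (mem_indepSubsets.2 ⟨hlP, hli⟩)
    have hlS : (totalSize d l.toFinset : ℝ) ≤ S := by
      rw [hS, hS₂max]
      exact_mod_cast totalSize_le_maxSize hli hlP
    have hdens : ∀ e ∈ l.toFinset, τ ≤ (d e).density := fun e he => (hP e (hlP he)).2
    have hlH0 := shiftedDensity_nonneg hdens
    have hle₁ : b₁ / H * shiftedDensity d τ l.toFinset ≤ b₁ :=
      (mul_le_mul_of_nonneg_left hlH (by positivity)).trans hc₁.le
    have hle₂ : b₂ / S * totalSize d l.toFinset ≤ b₂ :=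
      (mul_le_mul_of_nonneg_left hlS (by positivity)).trans hc₂.le
    rcases kept_spec hC hd hτ hl (fun e he => hP e (hlP (by simpa using he)))
      (fun e he => hm e (hlP (by simpa using he)) (hli.subset (by simpa using he)))
      with ⟨hall, hsmall⟩ | hbig
    · have hsur := hC.surplus_nonneg hsmall
      rw [hall]
      constructor
      · rw [hd.profit_eq τ]
        have : b₁ / H ≤ 1 := div_le_one_of_le₀ hb₁H hH0
        nlinarith
      · refine le_trans ?_ (hd.surplus_le_profit hdens)
        set s := totalSize d l.toFinset with hs
        rcases le_total (f₀ - m) 0 with hneg | hpos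
        · rw [hb₂, max_eq_left hneg]
          simpa using hsur
        · have hb₂f : b₂ ≤ f₀ := by
            rw [hb₂, max_eq_right hpos]
            linarith
          rcases le_total x₀ s with hxs | hxs
          · exact hle₂.trans (hb₂f.trans (hC.surplus_le_of_marginalCost_le hxs hsmall))
          · have h1 := hC.mul_surplus_le τ hxs
            rcases hS0.eq_or_lt with hS0' | hS0'
            · rw [← hS0']
              simpa using hsur
            · rw [div_mul_eq_mul_div, div_le_iff₀ hS0']
              have h2 : b₂ * s ≤ f₀ * s := mul_le_mul_of_nonneg_right hb₂f (Nat.cast_nonneg s)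
              have h3 : x₀ * surplus C τ s ≤ S * surplus C τ s :=
                mul_le_mul_of_nonneg_right hx₀S hsur
              linarith
    · have hF' := hbig x₁
      have hf₀' := hbig x₀
      exact ⟨hle₁.trans (max_le hkept0 ((min_le_right _ _).trans (by linarith))),
        hle₂.trans (max_le hkept0 (by linarith))⟩
  · rw [hc₁, hc₂]
    have h1 : min H (F - m) ≤ b₁ := le_max_right _ _
    have h2 : f₀ - m ≤ b₂ := le_max_right _ _
    rcases min_cases H (F - m) with h | h <;>
      rcases min_cases (maxProfit C M d P) F with h' | h' <;> linarith

end Kept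

/-! ### Comparing single elements -/

section Rank

variable {U : Type} {C : ℕ → ℕ} {d : U → Request} {M : Matroid U}

/-- The elements are compared by profit, ties being broken by density. -/
def rank (C : ℕ → ℕ) (d : U → Request) (e : U) : ℝ ×ₗ ℝ := toLex (profit C d {e}, (d e).density)

theorem beats_iff {X : Finset U} {e : U} : Beats C M d X e ↔
    M.Indep {e} ∧ 0 < profit C d {e} ∧ ∀ x ∈ X, M.Indep {x} → rank C d x < rank C d e := by
  simp only [Beats, rank, Prod.Lex.toLex_lt_toLex]

theorem IsInstance.rank_injective (hd : IsInstance d) : Function.Injective (rank C d) := by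
  intro x y h
  exact hd.density_injective (congrArg (fun z => (ofLex z).2) h)

end Rank

/-! ### Random halves -/

section Halves

variable {U : Type} [DecidableEq U] {C : ℕ → ℕ} {d : U → Request} {M : Matroid U}

/-- A set without very profitable elements splits into two profitable parts. -/
theorem exists_split (hC : IsCost C) {O : Finset U} {m : ℝ} (hm0 : 0 ≤ m)
    (hm : ∀ e ∈ O, profit C d {e} ≤ m) (hmO : 3 * m ≤ profit C d O) :
    ∃ A ⊆ O, profit C d O ≤ 3 * profit C d A ∧ profit C d O ≤ 3 * profit C d (O \ A) := by
  rcases (show 0 ≤ profit C d O by linarith).eq_or_lt with h0 | h0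
  · exact ⟨∅, by simp, by simp [profit_empty hC, ← h0], by simp [← h0]⟩
  -- A minimal part worth a third overshoots by less than one element: it is worth less than a third
  -- plus `m`, hence at most two thirds, and subadditivity leaves a third for the complement.
  obtain ⟨A, hA, hmin⟩ := Finset.exists_min_image
    (O.powerset.filter fun A => profit C d O ≤ 3 * profit C d A) Finset.card
    ⟨O, by simpa using by linarith⟩
  rw [Finset.mem_filter, Finset.mem_powerset] at hA
  have hAne : A.Nonempty := by
    rw [Finset.nonempty_iff_ne_empty]
    rintro rfl
    rw [profit_empty hC] at hA
    linarith [hA.2]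
  obtain ⟨e, he⟩ := hAne
  have h1 : 3 * profit C d (A.erase e) < profit C d O := by
    by_contra hcon
    have := hmin (A.erase e) (by
      rw [Finset.mem_filter, Finset.mem_powerset]
      exact ⟨(Finset.erase_subset _ _).trans hA.1, not_lt.1 hcon⟩)
    have := Finset.card_erase_lt_of_mem he
    omega
  have h2 := profit_union_le (d := d) hC (show Disjoint {e} (A.erase e) by simp)
  rw [← Finset.insert_eq, Finset.insert_erase he] at h2
  have h3 := profit_union_le (d := d) hC (Finset.disjoint_sdiff : Disjoint A (O \ A))
  rw [Finset.union_sdiff_of_subset hA.1] at h3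
  exact ⟨A, hA.1, hA.2, by linarith [hm e (hA.1 he)]⟩

/-- Flipping membership in `A` is injective on samples and maps `s` to a disjoint subset of `t`.
This is the counting form of a conditional probability being at most one half. -/
theorem two_mul_card_le_of_symmDiff {s t : Finset (Finset U)} (A : Finset U)
    (hst : s ⊆ t) (h : ∀ X ∈ s, symmDiff X A ∈ t ∧ symmDiff X A ∉ s) :
    2 * s.card ≤ t.card := by
  have hinj : Function.Injective fun X : Finset U => symmDiff X A := symmDiff_left_injective A
  have h1 : (s.image fun X => symmDiff X A).card = s.card := Finset.card_image_of_injective s hinj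
  have h2 : Disjoint s (s.image fun X => symmDiff X A) := by
    rw [Finset.disjoint_left]
    intro X hX hX'
    obtain ⟨Y, hY, rfl⟩ := Finset.mem_image.1 hX'
    exact (h Y hY).2 hX
  have h3 : s ∪ s.image (fun X => symmDiff X A) ⊆ t := by
    refine Finset.union_subset hst fun X hX => ?_
    obtain ⟨Y, hY, rfl⟩ := Finset.mem_image.1 hX
    exact (h Y hY).1
  have := Finset.card_le_card h3
  rw [Finset.card_union_of_disjoint h2, h1] at this
  omega

variable [Fintype U]

/-- At least three quarters of all samples contain a constant fraction of the profit of a set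
without very profitable elements. -/
theorem four_mul_card_bad_samples_le (hC : IsCost C) {O : Finset U} (hO : M.Indep (O : Set U))
    {m : ℝ} (hm0 : 0 ≤ m) (hm : ∀ e ∈ O, profit C d {e} ≤ m) (hmO : 3 * m ≤ profit C d O) :
    4 * (Finset.univ.filter fun X : Finset U =>
      6 * maxProfit C M d (X ∩ O) < profit C d O).card ≤ 2 ^ Fintype.card U := by
  obtain ⟨A, hAO, hA, hB⟩ := exists_split (d := d) hC hm0 hm hmO
  set B := O \ A with hBdef
  have hBO : B ⊆ O := Finset.sdiff_subset
  have hAB : Disjoint A B := Finset.disjoint_sdiff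
  -- Flipping on `D` exchanges the sampled and the unsampled part of `D`. By subadditivity one of
  -- them is worth half of `D`, hence a sixth of `O`, so a sample and its flip are not both bad.
  have hpart (D : Finset U) (hDO : D ⊆ O) (hD : profit C d O ≤ 3 * profit C d D)
      (X : Finset U) (h1 : 6 * maxProfit C M d (X ∩ D) < profit C d O) :
      ¬ 6 * maxProfit C M d (symmDiff X D ∩ D) < profit C d O := by
    intro h2
    have h3 : symmDiff X D ∩ D = D \ (X ∩ D) := by
      ext e
      simp only [Finset.mem_inter, Finset.mem_symmDiff, Finset.mem_sdiff]
      tauto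
    have hXD : X ∩ D ⊆ D := Finset.inter_subset_right
    have h4 := profit_union_le (d := d) hC (Finset.disjoint_sdiff : Disjoint (X ∩ D) (D \ (X ∩ D)))
    rw [Finset.union_sdiff_of_subset hXD] at h4
    have h5 := profit_le_maxProfit (C := C) (d := d)
      (hO.subset (show ((X ∩ D : Finset U) : Set U) ⊆ O by exact_mod_cast hXD.trans hDO))
      (subset_refl _)
    have h6 := profit_le_maxProfit (C := C) (d := d)
      (hO.subset (show ((D \ (X ∩ D) : Finset U) : Set U) ⊆ O by
        exact_mod_cast Finset.sdiff_subset.trans hDO)) (subset_refl _)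
    rw [h3] at h2
    linarith
  have hdisj (X D E : Finset U) (hDE : Disjoint D E) : symmDiff X D ∩ E = X ∩ E := by
    ext e
    have : e ∈ D → e ∉ E := fun h => Finset.disjoint_left.1 hDE h
    simp only [Finset.mem_inter, Finset.mem_symmDiff]
    tauto
  set s₂ := Finset.univ.filter fun X : Finset U => 6 * maxProfit C M d (X ∩ B) < profit C d O
    with hs₂
  -- Flipping on `A` leaves the sample on `B` unchanged, so the bad events for `A` and `B` behave
  -- independently and together hold for at most a quarter of the samples.
  set s₁ := s₂.filter fun X => 6 * maxProfit C M d (X ∩ A) < profit C d O with hs₁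
  have h1 : 2 * s₁.card ≤ s₂.card := by
    refine two_mul_card_le_of_symmDiff A (Finset.filter_subset _ _) fun X hX => ?_
    simp only [hs₁, hs₂, Finset.mem_filter, Finset.mem_univ, true_and] at hX ⊢
    rw [hdisj X A B hAB]
    exact ⟨hX.1, fun h => hpart A hAO hA X hX.2 h.2⟩
  have h2 : 2 * s₂.card ≤ (Finset.univ : Finset (Finset U)).card := by
    refine two_mul_card_le_of_symmDiff B (Finset.subset_univ _) fun X hX => ?_
    simp only [hs₂, Finset.mem_filter, Finset.mem_univ, true_and] at hX ⊢
    exact hpart B hBO hB X hX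
  have h3 : (Finset.univ.filter fun X : Finset U =>
      6 * maxProfit C M d (X ∩ O) < profit C d O) ⊆ s₁ := by
    intro X hX
    simp only [hs₁, hs₂, Finset.mem_filter, Finset.mem_univ, true_and] at hX ⊢
    have hA' := maxProfit_mono (C := C) (M := M) (d := d)
      (Finset.inter_subset_inter_left hAO : X ∩ A ⊆ X ∩ O)
    have hB' := maxProfit_mono (C := C) (M := M) (d := d)
      (Finset.inter_subset_inter_left hBO : X ∩ B ⊆ X ∩ O)
    exact ⟨by linarith, by linarith⟩
  have h4 := Finset.card_le_card h3
  rw [Finset.card_univ, Fintype.card_finset] at h2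
  omega

/-- For at least half of all samples, both the sample and the dense part of the remainder are
profitable. -/
theorem exists_good_samples (hC : IsCost C) (W : Finset U)
    {m : ℝ} (hm0 : 0 ≤ m) (hm : ∀ e ∈ W, M.Indep {e} → profit C d {e} ≤ m)
    (hmW : 8640 * m ≤ maxProfit C M d W) (hW0 : 0 < maxProfit C M d W) :
    ∃ G : Finset (Finset U), 2 ^ Fintype.card U ≤ 2 * G.card ∧ ∀ X ∈ G,
      maxProfit C M d W ≤ 6 * maxProfit C M d (X ∩ W) ∧
      ∀ τ, maxProfit C M d W ≤ 2880 * maxProfit C M d (densityPrefix d τ (X ∩ W)) →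
        maxProfit C M d W ≤ 17280 * maxProfit C M d (densityPrefix d τ (Xᶜ ∩ W)) := by
  classical
  set V := maxProfit C M d W with hV
  have hmO {O : Finset U} (hOW : O ⊆ W) (hO : M.Indep (O : Set U)) :
      ∀ e ∈ O, profit C d {e} ≤ m := fun e he =>
    hm e (hOW he) (hO.subset (by simpa using he))
  obtain ⟨O, hOW, hO, hOpi⟩ := exists_profit_eq_maxProfit C M d W
  have hWne : W.Nonempty := by
    rw [Finset.nonempty_iff_ne_empty]
    rintro rfl
    rw [Finset.subset_empty] at hOW
    rw [hOW, profit_empty hC] at hOpi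
    linarith
  -- The threshold depends on the sample, so the event must be fixed in advance. The densest element
  -- whose prefix is worth `V / 2880` defines a set `Q` lying inside the prefix of every admissible
  -- threshold. It is enough that the remainder keeps a sixth of `Q`: 17280 = 6 · 2880.
  set Γ := W.filter fun e => V ≤ 2880 * maxProfit C M d (densityPrefix d (d e).density W) with hΓ
  have hΓmem (τ : ℝ) (hτ : V ≤ 2880 * maxProfit C M d (densityPrefix d τ W)) :
      ∃ e ∈ Γ, τ ≤ (d e).density := by
    have hne : (densityPrefix d τ W).Nonempty := by
      rw [Finset.nonempty_iff_ne_empty]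
      intro h
      obtain ⟨S, hS, -, hSpi⟩ := exists_profit_eq_maxProfit C M d (densityPrefix d τ W)
      rw [h, Finset.subset_empty] at hS
      rw [← hSpi, hS, profit_empty hC] at hτ
      linarith
    obtain ⟨e, he, hmin⟩ := Finset.exists_min_image _ (fun e => (d e).density) hne
    obtain ⟨heW, hle⟩ := mem_densityPrefix.1 he
    refine ⟨e, Finset.mem_filter.2 ⟨heW, hτ.trans ?_⟩, hle⟩
    exact mul_le_mul_of_nonneg_left (maxProfit_mono fun x hx =>
      mem_densityPrefix.2 ⟨densityPrefix_subset _ _ _ hx, hmin x hx⟩) (by norm_num)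
  have hΓne : Γ.Nonempty := by
    obtain ⟨e, -, hmin⟩ := Finset.exists_min_image W (fun e => (d e).density) hWne
    have : densityPrefix d (d e).density W = W :=
      (densityPrefix_subset _ _ _).antisymm fun x hx => mem_densityPrefix.2 ⟨hx, hmin x hx⟩
    obtain ⟨x, hx, -⟩ := hΓmem (d e).density (by rw [this]; linarith)
    exact ⟨x, hx⟩
  obtain ⟨e, he, hmax⟩ := Finset.exists_max_image Γ (fun e => (d e).density) hΓne
  rw [hΓ, Finset.mem_filter] at he
  obtain ⟨Q, hQW, hQ, hQpi⟩ := exists_profit_eq_maxProfit C M d (densityPrefix d (d e).density W)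
  -- `Q` is only worth `V / 2880`, and splitting it needs three times `m`: this is where 8640 = 3 ·
  -- 2880 comes from.
  have hb₁ := four_mul_card_bad_samples_le (d := d) hC hO hm0 (hmO hOW hO) (by linarith)
  have hb₂ := four_mul_card_bad_samples_le (d := d) hC hQ hm0
    (hmO (hQW.trans (densityPrefix_subset _ _ _)) hQ) (by linarith)
  set s₁ := Finset.univ.filter fun X : Finset U => 6 * maxProfit C M d (X ∩ O) < profit C d O
    with hs₁
  set s₂ := Finset.univ.filter fun X : Finset U => 6 * maxProfit C M d (X ∩ Q) < profit C d Q
    with hs₂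
  -- The remainder of a uniformly random sample is itself uniformly random, so the bound for `Q`
  -- holds for complements too. The two bad events exclude at most half of the samples.
  have hs₂c : (s₂.image compl).card = s₂.card := Finset.card_image_of_injective s₂ compl_injective
  refine ⟨(s₁ ∪ s₂.image compl)ᶜ, ?_, fun X hX => ?_⟩
  · have h1 := Finset.card_add_card_compl (s₁ ∪ s₂.image compl)
    have h2 := Finset.card_union_le s₁ (s₂.image compl)
    rw [Fintype.card_finset] at h1
    omega
  · rw [Finset.mem_compl, Finset.mem_union, not_or] at hX
    obtain ⟨hX₁, hX₂⟩ := hX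
    replace hX₂ : Xᶜ ∉ s₂ := fun h => hX₂ (Finset.mem_image.2 ⟨Xᶜ, h, compl_compl X⟩)
    constructor
    · have h1 : V ≤ 6 * maxProfit C M d (X ∩ O) := by
        simpa [hs₁, hOpi, ← hV] using hX₁
      have h2 := maxProfit_mono (C := C) (M := M) (d := d)
        (Finset.inter_subset_inter_left hOW : X ∩ O ⊆ X ∩ W)
      linarith
    · intro τ hτ
      have h1 : maxProfit C M d (densityPrefix d τ (X ∩ W)) ≤
          maxProfit C M d (densityPrefix d τ W) := by
        refine maxProfit_mono fun x hx => ?_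
        rw [mem_densityPrefix] at hx ⊢
        exact ⟨Finset.inter_subset_right hx.1, hx.2⟩
      obtain ⟨x, hx, hle⟩ := hΓmem τ (by linarith)
      have h2 : profit C d Q ≤ 6 * maxProfit C M d (Xᶜ ∩ Q) := by
        simpa [hs₂] using hX₂
      have h3 : maxProfit C M d (Xᶜ ∩ Q) ≤ maxProfit C M d (densityPrefix d τ (Xᶜ ∩ W)) := by
        refine maxProfit_mono fun y hy => ?_
        rw [Finset.mem_inter] at hy
        obtain ⟨hyW, hyd⟩ := mem_densityPrefix.1 (hQW hy.2)
        exact mem_densityPrefix.2 ⟨Finset.mem_inter.2 ⟨hy.1, hyW⟩,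
          hle.trans ((hmax x hx).trans hyd)⟩
      linarith [he.2]

theorem two_pow_le_two_mul_card_notMem (b : U) :
    2 ^ Fintype.card U ≤ 2 * (Finset.univ.filter fun X : Finset U => b ∉ X).card := by
  have h1 := two_mul_card_le_of_symmDiff {b} (Finset.subset_univ
    (Finset.univ.filter fun X : Finset U => b ∈ X)) fun X hX => by
      simpa [Finset.mem_symmDiff] using hX
  have h2 := Finset.card_filter_add_card_filter_not (s := (Finset.univ : Finset (Finset U)))
    (fun X => b ∈ X)
  rw [Finset.card_univ, Fintype.card_finset] at h1 h2
  omega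

theorem two_pow_le_four_mul_card_notMem_mem {b c : U} (hbc : b ≠ c) :
    2 ^ Fintype.card U ≤ 4 * (Finset.univ.filter fun X : Finset U => b ∉ X ∧ c ∈ X).card := by
  have h1 := two_mul_card_le_of_symmDiff {c}
    (Finset.filter_subset (fun X => c ∉ X) (Finset.univ.filter fun X : Finset U => b ∉ X))
    fun X hX => by
      simp only [Finset.mem_filter, Finset.mem_univ, true_and, Finset.mem_symmDiff,
        Finset.mem_singleton] at hX ⊢
      tauto
  have h2 := Finset.card_filter_add_card_filter_not
    (s := Finset.univ.filter fun X : Finset U => b ∉ X) (fun X => c ∈ X)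
  have h3 := two_pow_le_two_mul_card_notMem b
  rw [Finset.filter_filter] at h2
  omega

/-- For at least a quarter of all samples, the most profitable single element is the only one that
beats the sample. -/
theorem exists_separating_samples (hd : IsInstance d) {a : U} (ha : M.Indep {a})
    (hpos : 0 < profit C d {a}) :
    ∃ b, profit C d {a} ≤ profit C d {b} ∧ ∃ G : Finset (Finset U),
      2 ^ Fintype.card U ≤ 4 * G.card ∧
      ∀ X ∈ G, b ∉ X ∧ Beats C M d X b ∧ ∀ y ∉ X, Beats C M d X y → y = b := by
  classical
  obtain ⟨b, hb, hmax⟩ := Finset.exists_max_image (Finset.univ.filter fun e => M.Indep {e})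
    (rank C d) ⟨a, by simpa using ha⟩
  simp only [Finset.mem_filter, Finset.mem_univ, true_and] at hb hmax
  have hab : profit C d {a} ≤ profit C d {b} := by
    rcases Prod.Lex.toLex_le_toLex.1 (hmax a ha) with h | h
    · exact h.le
    · exact h.1.le
  have hbeats (X : Finset U) (hX : b ∉ X) : Beats C M d X b :=
    beats_iff.2 ⟨hb, hpos.trans_le hab, fun x hx hxi => lt_of_le_of_ne (hmax x hxi) fun h =>
      hX (hd.rank_injective h ▸ hx)⟩
  refine ⟨b, hab, ?_⟩
  rcases (Finset.univ.filter fun e => M.Indep {e} ∧ e ≠ b).eq_empty_or_nonempty with h | h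
  · refine ⟨_, (two_pow_le_two_mul_card_notMem b).trans
      (Nat.mul_le_mul_right _ (by norm_num)), fun X hX => ?_⟩
    rw [Finset.mem_filter] at hX
    refine ⟨hX.2, hbeats X hX.2, fun y _ hy => ?_⟩
    by_contra hne
    exact Finset.notMem_empty y (h ▸ Finset.mem_filter.2 ⟨Finset.mem_univ y, hy.1, hne⟩)
  -- With the runner-up `c` in the sample, nothing but `b` can beat the sample.
  · obtain ⟨c, hc, hcmax⟩ := Finset.exists_max_image _ (rank C d) h
    simp only [Finset.mem_filter, Finset.mem_univ, true_and] at hc hcmax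
    refine ⟨_, two_pow_le_four_mul_card_notMem_mem hc.2.symm, fun X hX => ?_⟩
    rw [Finset.mem_filter] at hX
    refine ⟨hX.2.1, hbeats X hX.2.1, fun y _ hy => ?_⟩
    by_contra hne
    exact absurd ((beats_iff.1 hy).2.2 c hX.2.2 hc.1) (not_lt.2 (hcmax y ⟨hy.1, hne⟩))

end Halves

/-! ### Histories -/

section History

variable {U D : Type}

/-- The history in which the elements of `l` arrived, most recent arrival first. -/
def history (d : U → D) (l : List U) : List (U × D) := l.map fun e => (e, d e)

@[simp]
theorem history_nil (d : U → D) : history d [] = [] := rfl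

@[simp]
theorem history_cons (d : U → D) (e : U) (l : List U) :
    history d (e :: l) = (e, d e) :: history d l := rfl

@[simp]
theorem history_append (d : U → D) (l₁ l₂ : List U) :
    history d (l₁ ++ l₂) = history d l₁ ++ history d l₂ := List.map_append

@[simp]
theorem length_history (d : U → D) (l : List U) : (history d l).length = l.length :=
  List.length_map _

@[simp]
theorem map_fst_history (d : U → D) (l : List U) : (history d l).map Prod.fst = l := by
  rw [history, List.map_map]
  exact List.map_id l

theorem mem_history {d : U → D} {l : List U} {y : U × D} :
    y ∈ history d l ↔ y.1 ∈ l ∧ y.2 = d y.1 := by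
  rw [history, List.mem_map]
  constructor
  · rintro ⟨e, he, rfl⟩
    exact ⟨he, rfl⟩
  · rintro ⟨h1, h2⟩
    exact ⟨y.1, h1, Prod.ext rfl h2.symm⟩

theorem fullHistory_eq [Fintype U] (σ : Order U) (d : U → D) :
    fullHistory σ d = history d (List.ofFn σ).reverse := by
  rw [fullHistory, history, List.map_reverse, List.map_ofFn]
  rfl

theorem lookup_history [DecidableEq U] (d : U → Request) {l : List U} {e : U} (h : e ∈ l) :
    lookup (history d l) e = d e := by
  induction l with
  | nil => simp at h
  | cons x l ih =>
    rw [lookup, history_cons, List.lookup_cons]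
    by_cases hx : e = x
    · simp [hx]
    · rw [beq_false_of_ne hx]
      exact ih ((List.mem_cons.1 h).resolve_left hx)

theorem picked_sublist {β : Type} (p : β → List β → Bool) (h : List β) :
    (picked p h).Sublist h := by
  induction h with
  | nil => exact List.Sublist.slnil
  | cons a h ih =>
    rw [picked]
    split_ifs
    · exact ih.cons_cons a
    · exact ih.cons a

theorem map_fst_picked_sublist (p : U × D → List (U × D) → Bool) (d : U → D) (l : List U) :
    ((picked p (history d l)).map Prod.fst).Sublist l := by
  simpa using (picked_sublist p (history d l)).map Prod.fst

/-- Since the latest arrival is at the head, `l₂` is what had arrived before `e`. -/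
theorem mem_map_fst_picked {p : U × D → List (U × D) → Bool} {d : U → D} {l : List U} {e : U} :
    e ∈ (picked p (history d l)).map Prod.fst ↔
      ∃ l₁ l₂, l = l₁ ++ e :: l₂ ∧ p (e, d e) (history d l₂) = true := by
  induction l with
  | nil => simp [picked]
  | cons x l ih =>
    rw [history_cons, picked]
    have hsplit : (∃ l₁ l₂, x :: l = l₁ ++ e :: l₂ ∧ p (e, d e) (history d l₂) = true) ↔
        (x = e ∧ p (e, d e) (history d l) = true) ∨
          ∃ l₁ l₂, l = l₁ ++ e :: l₂ ∧ p (e, d e) (history d l₂) = true := by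
      constructor
      · rintro ⟨l₁, l₂, h, hp⟩
        cases l₁ with
        | nil =>
          rw [List.nil_append, List.cons.injEq] at h
          exact Or.inl ⟨h.1, h.2 ▸ hp⟩
        | cons y l₁ =>
          rw [List.cons_append, List.cons.injEq] at h
          exact Or.inr ⟨l₁, l₂, h.2, hp⟩
      · rintro (⟨rfl, hp⟩ | ⟨l₁, l₂, rfl, hp⟩)
        · exact ⟨[], l, rfl, hp⟩
        · exact ⟨x :: l₁, l₂, rfl, hp⟩
    rw [hsplit, ← ih]
    split_ifs with h
    · rw [List.map_cons, List.mem_cons]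
      refine or_congr_left ⟨fun he => ?_, fun he => he.1.symm⟩
      obtain rfl : e = x := he
      exact ⟨rfl, h⟩
    · refine (or_iff_right fun he => h ?_).symm
      obtain ⟨rfl, hp⟩ := he
      exact hp

theorem mem_output_iff [Fintype U] [DecidableEq U] {A : OnlineAlg U D} {ω : A.Ω} {σ : Order U}
    {d : U → D} {e : U} : e ∈ A.output ω σ d ↔
      ∃ l₁ l₂, (List.ofFn σ).reverse = l₁ ++ e :: l₂ ∧
        A.accept ω (e, d e) (history d l₂) = true := by
  rw [OnlineAlg.output, List.mem_toFinset, fullHistory_eq, mem_map_fst_picked]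

end History

/-! ### Running a subroutine on the stream after the sample -/

section Interleave

variable {U : Type} [DecidableEq U]

theorem interleave_nil_right (X : Finset U) (θ : List U) : interleave X θ [] = [] := by
  cases θ <;> rfl

/-- If the elements outside `X` arrive in an order that is obtained from `θ` by applying `g`, then
the interleaved stream is the stream `θ` with `g` applied to it. -/
theorem exists_interleave_eq (X : Finset U) (g : U → U) (hgX : ∀ x ∈ X, g x = x)
    (w w' : U → ℝ) (hw'X : ∀ x ∈ X, w' x = 0) (hw' : ∀ x ∉ X, w' x = w x) (θ : List U)
    {Y₁ Y₂ : List U} {e : U} (hY : ∀ x ∈ Y₁ ++ e :: Y₂, x ∉ X)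
    (hθ : (θ.filter fun x => x ∉ X).map g = Y₁ ++ e :: Y₂) :
    ∃ T₁ T₂, θ.map g = T₁ ++ e :: T₂ ∧
      interleave X θ (history w (Y₁ ++ [e])) = history w' (T₁ ++ [e]) := by
  induction θ generalizing Y₁ with
  | nil => simp at hθ
  | cons u θ ih =>
    by_cases hu : u ∈ X
    · rw [List.filter_cons_of_neg (by simpa using hu)] at hθ
      obtain ⟨T₁, T₂, h1, h2⟩ := ih hY hθ
      refine ⟨u :: T₁, T₂, by rw [List.map_cons, h1, hgX u hu, List.cons_append], ?_⟩
      obtain ⟨a, l, hal⟩ : ∃ a l, history w (Y₁ ++ [e]) = a :: l :=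
        List.exists_cons_of_ne_nil (by simp)
      rw [hal] at h2 ⊢
      rw [interleave, if_pos hu, h2, List.cons_append, history_cons, hw'X u hu]
    · rw [List.filter_cons_of_pos (by simpa using hu), List.map_cons] at hθ
      cases Y₁ with
      -- No actual arrival follows `e`, so interleaving stops at `e`; the rest of `θ` goes into `T₂`
      -- and is not seen by the subroutine.
      | nil =>
        rw [List.nil_append, List.cons.injEq] at hθ
        refine ⟨[], θ.map g, by rw [List.map_cons, hθ.1, List.nil_append], ?_⟩
        rw [List.nil_append, history_cons, history_nil, interleave, if_neg hu,
          interleave_nil_right, history_cons, history_nil, hw' e (hY e (by simp))]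
      | cons y Y₁ =>
        rw [List.cons_append, List.cons.injEq] at hθ
        obtain ⟨T₁, T₂, h1, h2⟩ := ih (fun x hx => hY x (by
          rw [List.cons_append]
          exact List.mem_cons_of_mem y hx)) hθ.2
        refine ⟨y :: T₁, T₂, by rw [List.map_cons, h1, hθ.1, List.cons_append], ?_⟩
        rw [List.cons_append, history_cons, interleave, if_neg hu, h2, List.cons_append,
          history_cons, hw' y (hY y (by simp))]

/-- The values of the requests for the subroutine when the sample `X` is made worthless. -/
def streamValue (C : ℕ → ℕ) (d : U → Request) (τ : ℝ) (b : Bool) (X : Finset U) (e : U) : ℝ :=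
  if e ∈ X then 0 else subroutineValue C τ b (d e)

/-- The result of the subroutine on the stream after the sample consists of those elements of its
result on a full stream that are eligible and outside the sample. -/
theorem mem_picked_inSubroutine [Fintype U] (C : ℕ → ℕ) (d : U → Request) (τ : ℝ) (b : Bool)
    (A : OnlineAlg U ℝ) (ω : A.Ω) (X : Finset U) (θ : Order U) (g : Equiv.Perm U)
    (hgX : ∀ x ∈ X, g x = x) {R : List U} (hRX : ∀ x, x ∈ R ↔ x ∉ X)
    (hθ : ((List.ofFn θ).filter fun x => x ∉ X).map g = R.reverse) {e : U} :
    e ∈ (picked (inSubroutine C τ b (A.accept ω) (List.ofFn θ) X) (history d R)).map Prod.fst ↔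
      e ∈ A.output ω (θ.trans g) (streamValue C d τ b X) ∧ e ∉ X ∧ Eligible C τ (d e) := by
  classical
  have hofFn : List.ofFn (θ.trans g) = (List.ofFn θ).map g := by
    rw [List.map_ofFn]
    rfl
  have hnodup : (List.ofFn (θ.trans g)).Nodup := List.nodup_ofFn.2 (θ.trans g).injective
  -- When `e` arrives, the simulated subroutine has seen exactly the part of the aligned full stream
  -- before `e`, so its decision is the one it takes there.
  have key (R₁ R₂ : List U) (hR : R = R₁ ++ e :: R₂) : ∃ T₁ T₂,
      List.ofFn (θ.trans g) = T₁ ++ e :: T₂ ∧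
      subroutine (A.accept ω) (List.ofFn θ) X (subroutineValue C τ b) (e, d e) (history d R₂) =
        A.accept ω (e, streamValue C d τ b X e) (history (streamValue C d τ b X) T₁.reverse) := by
    have hrev : R.reverse = R₂.reverse ++ e :: R₁.reverse := by simp [hR]
    obtain ⟨T₁, T₂, h1, h2⟩ := exists_interleave_eq X g hgX
      (fun e => subroutineValue C τ b (d e)) (streamValue C d τ b X)
      (fun x hx => by simp [streamValue, hx]) (fun x hx => by simp [streamValue, hx]) (List.ofFn θ)
      (fun x hx => (hRX x).1 (by rwa [← List.mem_reverse, hrev])) (hθ.trans hrev)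
    refine ⟨T₁, T₂, hofFn.trans h1, ?_⟩
    have h3 : (((e, d e) :: history d R₂).reverse.map
        fun a => (a.1, subroutineValue C τ b a.2)) =
        history (fun e => subroutineValue C τ b (d e)) (R₂.reverse ++ [e]) := by
      simp [history]
    have h4 : (history (streamValue C d τ b X) (T₁ ++ [e])).reverse =
        (e, streamValue C d τ b X e) :: history (streamValue C d τ b X) T₁.reverse := by
      simp [history]
    rw [subroutine, h3, h2, h4]
  rw [mem_map_fst_picked, mem_output_iff]
  constructor
  · rintro ⟨R₁, R₂, hR, hp⟩
    rw [inSubroutine, Bool.and_eq_true, decide_eq_true_iff] at hp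
    obtain ⟨T₁, T₂, h1, h2⟩ := key R₁ R₂ hR
    refine ⟨⟨T₂.reverse, T₁.reverse, by rw [h1]; simp, h2 ▸ hp.2⟩, (hRX e).1 (by simp [hR]), hp.1⟩
  · rintro ⟨⟨l₁, l₂, hl, hacc⟩, heX, hel⟩
    obtain ⟨R₁, R₂, hR⟩ := List.append_of_mem ((hRX e).2 heX)
    refine ⟨R₁, R₂, hR, ?_⟩
    rw [inSubroutine, Bool.and_eq_true, decide_eq_true_iff]
    refine ⟨hel, ?_⟩
    obtain ⟨T₁, T₂, h1, h2⟩ := key R₁ R₂ hR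
    have hrev : (List.ofFn (θ.trans g)).reverse = T₂.reverse ++ e :: T₁.reverse := by rw [h1]; simp
    -- Each element arrives once, so the splitting of the full stream at `e` is unique and the two
    -- pasts coincide.
    have hnd : (T₂.reverse ++ e :: T₁.reverse).Nodup := hrev ▸ List.nodup_reverse.2 hnodup
    rw [List.nodup_middle, List.nodup_cons, List.mem_append, not_or] at hnd
    obtain ⟨-, -, h3⟩ := (List.append_cons_inj_of_notMem hnd.1.1 hnd.1.2).1 (hrev.symm.trans hl)
    rw [h2, h3]
    exact hacc

/-- The online rule recomputes the kept set at each arrival from the subroutine's earlier picks.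
Their requests have all arrived, so the history gives the true data and the recomputation follows
the recursion of `kept`. -/
theorem picked_secondStage (C : ℕ → ℕ) (d : U → Request) (acc : U × ℝ → List (U × ℝ) → Bool)
    (τ : ℝ) (b : Bool) (θ : List U) (X : Finset U) (R : List U) :
    ((picked (secondStage C acc τ b θ X) (history d R)).map Prod.fst).toFinset =
      kept C d ((picked (inSubroutine C τ b acc θ X) (history d R)).map Prod.fst) := by
  classical
  induction R with
  | nil => rfl
  | cons e R ih =>
    set l := (picked (inSubroutine C τ b acc θ X) (history d R)).map Prod.fst with hl
    have hsub : ∀ x ∈ l, x ∈ R := fun x hx => (map_fst_picked_sublist _ d R).subset hx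
    have h1 : kept C (lookup (history d (e :: R))) l = kept C d l :=
      kept_congr fun x hx => lookup_history d (List.mem_cons_of_mem e (hsub x hx))
    have h2 : ∀ x ∈ insert e (kept C d l), lookup (history d (e :: R)) x = d x := by
      intro x hx
      refine lookup_history d ?_
      rw [Finset.mem_insert] at hx
      exact List.mem_cons.2 (hx.imp id fun hx => hsub x
        (List.mem_toFinset.1 (kept_subset C d l hx)))
    have h3 := profit_congr (C := C) h2
    have h4 := profit_congr (C := C) fun x hx =>
      h2 x (Finset.mem_insert_of_mem (a := x) (s := kept C d l) hx)
    have hstage : secondStage C acc τ b θ X (e, d e) (history d R) =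
        (inSubroutine C τ b acc θ X (e, d e) (history d R) &&
          decide (profit C d (kept C d l) ≤ profit C d (insert e (kept C d l)))) := by
      rw [secondStage]
      simp only [← hl, ← history_cons, h1, h3, h4]
    rw [history_cons, picked, picked, hstage]
    cases hin : inSubroutine C τ b acc θ X (e, d e) (history d R)
    · simpa using ih
    · simp only [Bool.true_and, decide_eq_true_eq, if_true, List.map_cons, ← hl]
      rw [kept_cons]
      split_ifs
      · rw [List.map_cons, List.toFinset_cons, ih]
      · exact ih

end Interleave

/-! ### The output of the online algorithm -/

section Output

variable {U : Type} {C : ℕ → ℕ} {M : Matroid U} {d : U → Request}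

theorem beats_congr {d d' : U → Request} {X : Finset U} {e : U} (h : ∀ x ∈ X, d x = d' x)
    (he : d e = d' e) : Beats C M d X e ↔ Beats C M d' X e := by
  have h1 : profit C d {e} = profit C d' {e} := profit_congr (by simpa using he)
  rw [Beats, Beats, h1, he]
  refine and_congr_right fun _ => and_congr_right fun _ => forall₂_congr fun x hx => ?_
  rw [profit_congr (C := C) (d := d) (d' := d') (S := {x}) (by simpa using h x hx), h x hx]

variable [DecidableEq U] [Fintype U] {acc : U × ℝ → List (U × ℝ) → Bool}
  {c : Coins U}

theorem profitAccept_of_lt {cur : U × Request} {past : List (U × Request)}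
    (h : past.length < c.1) : profitAccept C M acc c cur past = false := by
  rw [profitAccept]
  exact if_pos h

theorem picked_profitAccept_of_le {l : List U} (h : l.length ≤ c.1) :
    picked (profitAccept C M acc c) (history d l) = [] := by
  induction l with
  | nil => rfl
  | cons e l ih =>
    rw [List.length_cons] at h
    rw [history_cons, picked, profitAccept_of_lt (by simpa using h)]
    exact ih (by omega)

/-- `S` is the sample: it sits at the tail, being oldest, and contributes nothing. The rule
therefore only has to be matched on pasts that contain all of `S`. -/
theorem picked_profitAccept_append {S : List U} (hS : S.length = c.1)
    (p : U × Request → List (U × Request) → Bool) (R : List U)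
    (hp : ∀ e l, (∃ l', R = l' ++ e :: l) →
      profitAccept C M acc c (e, d e) (history d (l ++ S)) = p (e, d e) (history d l)) :
    picked (profitAccept C M acc c) (history d (R ++ S)) = picked p (history d R) := by
  induction R with
  | nil => exact picked_profitAccept_of_le (by simp [hS])
  | cons e R ih =>
    rw [List.cons_append, history_cons, history_cons, picked, picked, hp e R ⟨[], rfl⟩,
      ih fun e' l ⟨l', h⟩ => hp e' l ⟨e :: l', by rw [h, List.cons_append]⟩]

theorem profitAccept_append {S R : List U} (hS : S.length = c.1) (e : U) :
    profitAccept C M acc c (e, d e) (history d (R ++ S)) =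
      open scoped Classical in
      if c.2.1 then
        decide (Beats C M (lookup (history d (e :: (R ++ S)))) S.toFinset e ∧
          ∀ y ∈ history d R, ¬ Beats C M (lookup (history d (e :: (R ++ S)))) S.toFinset y.1)
      else
        match threshold C M d (S.toFinset.filter fun e => (d e).Whole C) with
        | none => false
        | some τ => secondStage C acc τ c.2.2.1 (List.ofFn c.2.2.2) S.toFinset (e, d e)
            (history d R) := by
  classical
  have hlen : (history d (R ++ S)).length - c.1 = (history d R).length := by simp [hS]
  have hlook : ∀ e ∈ S.toFinset, lookup (history d S) e = d e := fun e he =>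
    lookup_history d (List.mem_toFinset.1 he)
  have hfilter : (S.toFinset.filter fun e => (lookup (history d S) e).Whole C) =
      S.toFinset.filter fun e => (d e).Whole C :=
    Finset.filter_congr fun e he => by rw [hlook e he]
  have hthr := threshold_congr (C := C) (M := M) (d := lookup (history d S)) (d' := d)
    (T := S.toFinset.filter fun e => (d e).Whole C)
    fun e he => hlook e (Finset.mem_filter.1 he).1
  rw [profitAccept, if_neg (by simp [hS])]
  simp only [hlen]
  simp only [history_append, List.take_left, List.drop_left, map_fst_history, hfilter, hthr,
    history_cons]

/-- The single element algorithm takes the first element that beats the sample. -/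
theorem mem_picked_of_heads {S R : List U} (hS : S.length = c.1) (hc : c.2.1 = true) {e : U} :
    e ∈ (picked (profitAccept C M acc c) (history d (R ++ S))).map Prod.fst ↔
      ∃ l₁ l₂, R = l₁ ++ e :: l₂ ∧ Beats C M d S.toFinset e ∧
        ∀ y ∈ l₂, ¬ Beats C M d S.toFinset y := by
  classical
  rw [picked_profitAccept_append hS
    (fun cur past => decide (Beats C M d S.toFinset cur.1 ∧
      ∀ y ∈ past, ¬ Beats C M d S.toFinset y.1)) R, mem_map_fst_picked]
  · simp [mem_history]
  · intro e l _
    rw [profitAccept_append hS, if_pos hc]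
    have hb (y : U) (hy : y = e ∨ y ∈ l) :
        Beats C M (lookup (history d (e :: (l ++ S)))) S.toFinset y ↔
          Beats C M d S.toFinset y := by
      refine beats_congr (fun x hx => lookup_history d ?_) (lookup_history d ?_)
      · exact List.mem_cons_of_mem e (List.mem_append_right l (List.mem_toFinset.1 hx))
      · rcases hy with rfl | hy
        · exact List.mem_cons_self
        · exact List.mem_cons_of_mem e (List.mem_append_left S hy)
    rw [hb e (Or.inl rfl)]
    congr 1
    refine propext (and_congr_right fun _ => forall₂_congr fun y hy => ?_)
    rw [hb y.1 (Or.inr (mem_history.1 hy).1)]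

/-- Of two distinct accepted elements one would precede the other, and the later one is accepted
only if nothing before it beats the sample. -/
theorem picked_of_heads {S R : List U} (hS : S.length = c.1) (hc : c.2.1 = true) :
    ((picked (profitAccept C M acc c) (history d (R ++ S))).map Prod.fst).toFinset = ∅ ∨
      ∃ e ∈ R, Beats C M d S.toFinset e ∧
        ((picked (profitAccept C M acc c) (history d (R ++ S))).map Prod.fst).toFinset = {e} := by
  rcases Finset.eq_empty_or_nonempty
    ((picked (profitAccept C M acc c) (history d (R ++ S))).map Prod.fst).toFinset with h | ⟨e, he⟩
  · exact Or.inl h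
  · right
    have he' := he
    rw [List.mem_toFinset, mem_picked_of_heads hS hc] at he'
    obtain ⟨l₁, l₂, hR, hb, hl₂⟩ := he'
    refine ⟨e, by simp [hR], hb, Finset.eq_singleton_iff_unique_mem.2 ⟨he, fun x hx => ?_⟩⟩
    rw [List.mem_toFinset, mem_picked_of_heads hS hc] at hx
    obtain ⟨m₁, m₂, hR', hbx, hm₂⟩ := hx
    rw [hR, List.append_eq_append_iff] at hR'
    rcases hR' with ⟨r, rfl, h⟩ | ⟨r, rfl, h⟩
    · cases r with
      | nil =>
        rw [List.nil_append, List.cons.injEq] at h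
        exact h.1.symm
      | cons y r =>
        rw [List.cons_append, List.cons.injEq] at h
        exact absurd hbx (hl₂ x (by simp [h.2]))
    · cases r with
      | nil =>
        rw [List.nil_append, List.cons.injEq] at h
        exact h.1
      | cons y r =>
        rw [List.cons_append, List.cons.injEq] at h
        exact absurd hb (hm₂ e (by simp [h.2]))

theorem picked_of_heads_eq {S R : List U} (hS : S.length = c.1) (hc : c.2.1 = true) {b : U}
    (hb : b ∈ R) (hbeats : Beats C M d S.toFinset b)
    (hunique : ∀ y ∈ R, Beats C M d S.toFinset y → y = b) :
    ((picked (profitAccept C M acc c) (history d (R ++ S))).map Prod.fst).toFinset = {b} := by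
  rcases picked_of_heads (M := M) (acc := acc) (d := d) (C := C) (R := R) hS hc
    with h | ⟨e, he, hbe, h⟩
  · exfalso
    obtain ⟨l₁, l₂, h1, h2⟩ : ∃ l₁ l₂, R = l₁ ++ b :: l₂ ∧ b ∉ l₂ := by
      obtain ⟨l₁, l₂, h1, h2⟩ := List.eq_append_cons_of_mem (List.mem_reverse.2 hb)
      refine ⟨l₂.reverse, l₁.reverse, ?_, by simpa using h2⟩
      rw [← R.reverse_reverse, h1]
      simp
    have : b ∈ (picked (profitAccept C M acc c) (history d (R ++ S))).map Prod.fst :=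
      (mem_picked_of_heads hS hc).2 ⟨l₁, l₂, h1, hbeats, fun y hy hby =>
        h2 (hunique y (by simp [h1, hy]) hby ▸ hy)⟩
    rw [← List.mem_toFinset, h] at this
    exact Finset.notMem_empty b this
  · rw [h, hunique e he hbe]

theorem picked_of_tails_none {S R : List U} (hS : S.length = c.1) (hc : c.2.1 = false)
    (hτ : open scoped Classical in
      threshold C M d (S.toFinset.filter fun e => (d e).Whole C) = none) :
    ((picked (profitAccept C M acc c) (history d (R ++ S))).map Prod.fst).toFinset = ∅ := by
  rw [picked_profitAccept_append hS (fun _ _ => false) R]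
  · ext e
    rw [List.mem_toFinset, mem_map_fst_picked]
    simp
  · intro e l _
    rw [profitAccept_append hS, hc, hτ]
    rfl

theorem picked_of_tails {S R : List U} (hS : S.length = c.1) (hc : c.2.1 = false) {τ : ℝ}
    (hτ : open scoped Classical in
      threshold C M d (S.toFinset.filter fun e => (d e).Whole C) = some τ) :
    ((picked (profitAccept C M acc c) (history d (R ++ S))).map Prod.fst).toFinset =
      kept C d ((picked (inSubroutine C τ c.2.2.1 acc (List.ofFn c.2.2.2) S.toFinset)
        (history d R)).map Prod.fst) := by
  rw [← picked_secondStage, picked_profitAccept_append hS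
    (secondStage C acc τ c.2.2.1 (List.ofFn c.2.2.2) S.toFinset) R]
  intro e l _
  rw [profitAccept_append hS, hc, hτ]
  rfl

end Output

/-! ### Orders that start with a given set -/

section Orders

variable {U : Type}

theorem ofFn_trans [Fintype U] (σ : Order U) (g : Equiv.Perm U) :
    List.ofFn (σ.trans g) = (List.ofFn σ).map g := by
  rw [List.map_ofFn]
  rfl

theorem nodup_ofFn_order [Fintype U] (σ : Order U) : (List.ofFn σ).Nodup :=
  List.nodup_ofFn.2 σ.injective

theorem mem_ofFn_order [Fintype U] (σ : Order U) (x : U) : x ∈ List.ofFn σ :=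
  (List.mem_ofFn' _ _).2 (σ.surjective x)

variable [DecidableEq U]

theorem exists_perm_map_eq {l₁ l₂ : List U} (h₁ : l₁.Nodup) (h₂ : l₂.Nodup)
    (h : ∀ x, x ∈ l₁ ↔ x ∈ l₂) : ∃ g : Equiv.Perm U, l₁.map g = l₂ ∧ ∀ x ∉ l₁, g x = x := by
  have hlen : l₁.length = l₂.length := ((List.perm_ext_iff_of_nodup h₁ h₂).2 h).length_eq
  set p : Equiv.Perm {x // x ∈ l₁} := (h₁.getEquiv l₁).symm.trans ((finCongr hlen).trans
    ((h₂.getEquiv l₂).trans (Equiv.subtypeEquivRight fun x => (h x).symm))) with hp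
  refine ⟨Equiv.Perm.ofSubtype p, List.ext_getElem (by simpa using hlen) fun i hi hi' => ?_,
    fun x hx => Equiv.Perm.ofSubtype_apply_of_not_mem p hx⟩
  rw [List.length_map] at hi
  rw [List.getElem_map, Equiv.Perm.ofSubtype_apply_of_mem p (List.getElem_mem hi)]
  simp [hp, h₁.idxOf_getElem]

variable [Fintype U]

/-- The orders in which the elements of `X` come first. -/
def ordersFrom (X : Finset U) : Finset (Order U) :=
  Finset.univ.filter fun σ => ((List.ofFn σ).take X.card).toFinset = X

theorem mem_ordersFrom {X : Finset U} {σ : Order U} :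
    σ ∈ ordersFrom X ↔ ((List.ofFn σ).take X.card).toFinset = X := by
  simp [ordersFrom]

theorem trans_mem_ordersFrom {X : Finset U} {σ : Order U} (hσ : σ ∈ ordersFrom X)
    (g : Equiv.Perm U) : σ.trans g ∈ ordersFrom (X.image g) := by
  rw [mem_ordersFrom] at hσ ⊢
  rw [Finset.card_image_of_injective X g.injective, ofFn_trans, ← List.map_take]
  ext x
  rw [List.mem_toFinset, List.mem_map, Finset.mem_image]
  exact exists_congr fun a => and_congr_left fun _ => by
    rw [← List.mem_toFinset, hσ]

theorem mem_drop_iff {X : Finset U} {σ : Order U} (hσ : σ ∈ ordersFrom X) (x : U) :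
    x ∈ (List.ofFn σ).drop X.card ↔ x ∉ X := by
  have hnd := nodup_ofFn_order σ
  have hx := mem_ofFn_order σ x
  rw [← List.take_append_drop X.card (List.ofFn σ)] at hnd hx
  rw [mem_ordersFrom] at hσ
  rw [List.nodup_append'] at hnd
  have hX : x ∈ X ↔ x ∈ (List.ofFn σ).take X.card := by rw [← List.mem_toFinset, hσ]
  rw [hX]
  exact ⟨fun h h' => hnd.2.2 h' h, fun h => (List.mem_append.1 hx).resolve_left h⟩

theorem exists_order_ofFn_eq {l : List U} (hl : l.Nodup) (h : ∀ x, x ∈ l) :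
    ∃ σ : Order U, List.ofFn σ = l := by
  have hcard : Fintype.card U = l.length := by
    rw [← List.toFinset_card_of_nodup hl, ← Finset.card_univ]
    congr 1
    ext x
    simpa using h x
  refine ⟨(finCongr hcard).trans (hl.getEquivOfForallMemList l h),
    List.ext_getElem (by simpa using hcard) fun i hi hi' => ?_⟩
  simp

theorem ordersFrom_nonempty (X : Finset U) : (ordersFrom X).Nonempty := by
  obtain ⟨σ, hσ⟩ := exists_order_ofFn_eq (l := X.toList ++ Xᶜ.toList)
    (List.nodup_append'.2 ⟨X.nodup_toList, Finset.nodup_toList _, fun x hx hx' => by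
      rw [Finset.mem_toList] at hx hx'
      exact Finset.mem_compl.1 hx' hx⟩) (fun x => by simpa using em _)
  refine ⟨σ, mem_ordersFrom.2 ?_⟩
  rw [hσ, List.take_left' (by simp)]
  simp

/-- A permutation of the ground set that carries `X` to `X'` carries the orders starting with one to
orders starting with the other. -/
theorem card_ordersFrom_le {X X' : Finset U} (h : X.card = X'.card) :
    (ordersFrom X).card ≤ (ordersFrom X').card := by
  obtain ⟨σ, hσ⟩ := ordersFrom_nonempty X
  obtain ⟨σ', hσ'⟩ := ordersFrom_nonempty X'
  set g : Equiv.Perm U := σ.symm.trans σ' with hg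
  have hσg : σ.trans g = σ' := by
    ext i
    simp [hg]
  have h1 := trans_mem_ordersFrom hσ g
  have himage : X.image g = X' := by
    rw [hσg, mem_ordersFrom, Finset.card_image_of_injective X g.injective, h,
      mem_ordersFrom.1 hσ'] at h1
    exact h1.symm
  refine Finset.card_le_card_of_injOn (fun σ => σ.trans g)
    (fun σ hσ => himage ▸ trans_mem_ordersFrom hσ g) fun σ₁ _ σ₂ _ h => ?_
  ext i
  exact g.injective (by simpa using DFunLike.congr_fun h i)

theorem sum_orders_eq {k : ℕ} (hk : k ≤ Fintype.card U) (Q : Order U → ℝ) :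
    ∑ σ : Order U, Q σ =
      ∑ X ∈ Finset.powersetCard k (Finset.univ : Finset U), ∑ σ ∈ ordersFrom X, Q σ := by
  have hmaps : ∀ σ ∈ (Finset.univ : Finset (Order U)), ((List.ofFn σ).take k).toFinset ∈
      Finset.powersetCard k (Finset.univ : Finset U) := by
    intro σ _
    rw [Finset.mem_powersetCard_univ,
      List.toFinset_card_of_nodup ((nodup_ofFn_order σ).sublist (List.take_sublist _ _))]
    simpa using hk
  rw [← Finset.sum_fiberwise_of_maps_to hmaps]
  refine Finset.sum_congr rfl fun X hX => Finset.sum_congr ?_ fun _ _ => rfl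
  rw [Finset.mem_powersetCard_univ] at hX
  rw [ordersFrom, hX]

/-- Given its size, the sample is uniform: the orders are divided evenly among the sets of that
size. -/
theorem choose_mul_card_ordersFrom (X : Finset U) :
    ((Fintype.card U).choose X.card : ℝ) * (ordersFrom X).card =
      (Fintype.card (Order U) : ℝ) := by
  have h := sum_orders_eq (U := U) (X.card_le_univ) fun _ => (1 : ℝ)
  simp only [Finset.sum_const, nsmul_eq_mul, mul_one, Finset.card_univ] at h
  rw [h, Finset.sum_congr rfl fun X' hX' => by
    rw [le_antisymm (card_ordersFrom_le (Finset.mem_powersetCard_univ.1 hX'))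
      (card_ordersFrom_le (Finset.mem_powersetCard_univ.1 hX').symm)]]
  rw [Finset.sum_const, Finset.card_powersetCard, Finset.card_univ, nsmul_eq_mul]

/-- Averaging over the order and a binomial sample size amounts to averaging over the sample and
the orders that start with it. -/
theorem sum_le_sum_binomial (q : Finset U → ℝ) (Q : ℕ → Order U → ℝ)
    (h : ∀ X, (ordersFrom X).card * q X ≤ ∑ σ ∈ ordersFrom X, Q X.card σ) :
    (Fintype.card (Order U) : ℝ) * ∑ X, q X ≤
      ∑ σ, ∑ k ∈ Finset.Iic (Fintype.card U), ((Fintype.card U).choose k : ℝ) * Q k σ := by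
  rw [Finset.sum_comm]
  have h1 : ∀ k ∈ Finset.Iic (Fintype.card U),
      ∑ σ, ((Fintype.card U).choose k : ℝ) * Q k σ =
      ∑ X ∈ Finset.powersetCard k (Finset.univ : Finset U),
        ((Fintype.card U).choose k : ℝ) * ∑ σ ∈ ordersFrom X, Q k σ := fun k hk => by
    rw [← Finset.mul_sum, ← Finset.mul_sum, sum_orders_eq (Finset.mem_Iic.1 hk)]
  rw [Finset.sum_congr rfl h1, Finset.mul_sum]
  have hmaps : ∀ X ∈ (Finset.univ : Finset (Finset U)), X.card ∈ Finset.Iic (Fintype.card U) :=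
    fun X _ => Finset.mem_Iic.2 X.card_le_univ
  rw [← Finset.sum_fiberwise_of_maps_to hmaps]
  refine Finset.sum_le_sum fun k _ => ?_
  have h2 : (Finset.univ.filter fun X : Finset U => X.card = k) =
      Finset.powersetCard k Finset.univ := by
    ext X
    simp
  rw [h2]
  refine Finset.sum_le_sum fun X hX => ?_
  rw [Finset.mem_powersetCard_univ] at hX
  -- The binomial weight cancels the share of orders starting with `X`, so all samples, of whatever
  -- size, get equal weight.
  rw [← choose_mul_card_ordersFrom X, hX, mul_assoc]
  exact mul_le_mul_of_nonneg_left (hX ▸ h X) (Nat.cast_nonneg _)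

/-! ### Exchanging the order of the elements outside a set -/

theorem exists_align {X : Finset U} {σ : Order U} (hσ : σ ∈ ordersFrom X) (θ : Order U) :
    ∃ g : Equiv.Perm U, (∀ x ∈ X, g x = x) ∧
      ((List.ofFn θ).filter fun x => x ∉ X).map g = (List.ofFn σ).drop X.card := by
  obtain ⟨g, h1, h2⟩ := exists_perm_map_eq ((nodup_ofFn_order θ).filter fun x => x ∉ X)
    ((nodup_ofFn_order σ).sublist (List.drop_sublist X.card _)) fun x => by
      rw [mem_drop_iff hσ, List.mem_filter]
      simpa using fun _ => mem_ofFn_order θ x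
  exact ⟨g, fun x hx => h2 x (by simp [hx]), h1⟩

open scoped Classical in
/-- The permutation that fixes the elements of `X` and takes the others from their order in `θ` to
their order in `σ`. -/
def align (X : Finset U) (σ θ : Order U) : Equiv.Perm U :=
  if h : ∃ g : Equiv.Perm U, (∀ x ∈ X, g x = x) ∧
      ((List.ofFn θ).filter fun x => x ∉ X).map g = (List.ofFn σ).drop X.card
  then Classical.choose h else 1

theorem align_spec {X : Finset U} {σ : Order U} (hσ : σ ∈ ordersFrom X) (θ : Order U) :
    (∀ x ∈ X, align X σ θ x = x) ∧
      ((List.ofFn θ).filter fun x => x ∉ X).map (align X σ θ) = (List.ofFn σ).drop X.card := by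
  rw [align, dif_pos (exists_align hσ θ)]
  exact Classical.choose_spec (exists_align hσ θ)

theorem align_eq {X : Finset U} {σ : Order U} (hσ : σ ∈ ordersFrom X) {θ : Order U}
    {g : Equiv.Perm U} (hg : ∀ x ∈ X, g x = x)
    (hθ : ((List.ofFn θ).filter fun x => x ∉ X).map g = (List.ofFn σ).drop X.card) :
    align X σ θ = g := by
  obtain ⟨h1, h2⟩ := align_spec hσ θ
  ext x
  by_cases hx : x ∈ X
  · rw [h1 x hx, hg x hx]
  · exact List.map_inj_left.1 (h2.trans hθ.symm) x (by
      rw [List.mem_filter]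
      exact ⟨mem_ofFn_order θ x, by simpa using hx⟩)

/-- If `σ` is a uniformly random order starting with `X` and `θ` is an independent uniformly random
order, then aligning `θ` with `σ` results in a uniformly random order. -/
theorem sum_align (X : Finset U) (F : Order U → ℝ) :
    ∑ σ ∈ ordersFrom X, ∑ θ : Order U, F (θ.trans (align X σ θ)) =
      (ordersFrom X).card * ∑ θ, F θ := by
  -- With `g` the alignment of `(σ, θ)`, this moves `σ` by the inverse of `g` and `θ` by `g`. The
  -- alignment of the new pair is the inverse of `g`, so the map is an involution, and it carries
  -- the aligned order to the second coordinate.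
  set Ψ : Order U × Order U → Order U × Order U := fun p =>
    (Equiv.trans p.1 (align X p.1 p.2).symm, Equiv.trans p.2 (align X p.1 p.2)) with hΨ
  have hspec (p : Order U × Order U) (hp : p ∈ ordersFrom X ×ˢ Finset.univ) :
      Ψ p ∈ ordersFrom X ×ˢ Finset.univ ∧ Ψ (Ψ p) = p := by
    obtain ⟨σ, θ⟩ := p
    have hσ : σ ∈ ordersFrom X := (Finset.mem_product.1 hp).1
    obtain ⟨h1, h2⟩ := align_spec hσ θ
    set g := align X σ θ with hg
    have h1' : ∀ x ∈ X, g.symm x = x := fun x hx => by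
      rw [Equiv.symm_apply_eq, h1 x hx]
    have himage : X.image g.symm = X := by
      rw [Finset.image_congr (g := id) fun x hx => h1' x hx, Finset.image_id]
    have hσ' : σ.trans g.symm ∈ ordersFrom X := himage ▸ trans_mem_ordersFrom hσ g.symm
    refine ⟨Finset.mem_product.2 ⟨hσ', Finset.mem_univ _⟩, ?_⟩
    have hmem (x : U) : g x ∈ X ↔ x ∈ X := by
      constructor
      · intro hx
        have := h1' _ hx
        rw [Equiv.symm_apply_apply] at this
        rwa [← this] at hx
      · intro hx
        rwa [h1 x hx]
    have halign : align X (σ.trans g.symm) (θ.trans g) = g.symm := by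
      refine align_eq hσ' h1' ?_
      rw [ofFn_trans, ofFn_trans, List.filter_map, ← List.map_drop, ← h2]
      simp only [Function.comp_def, hmem]
    have hΨp : Ψ (σ, θ) = (σ.trans g.symm, θ.trans g) := rfl
    have hΨΨ : Ψ (σ.trans g.symm, θ.trans g) =
        ((σ.trans g.symm).trans (align X (σ.trans g.symm) (θ.trans g)).symm,
          (θ.trans g).trans (align X (σ.trans g.symm) (θ.trans g))) := rfl
    rw [hΨp, hΨΨ, halign]
    refine Prod.ext ?_ ?_ <;> ext i <;> simp
  have h1 : ∑ p ∈ ordersFrom X ×ˢ (Finset.univ : Finset (Order U)),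
      F (Equiv.trans p.2 (align X p.1 p.2)) =
      ∑ p ∈ ordersFrom X ×ˢ (Finset.univ : Finset (Order U)), F p.2 :=
    Finset.sum_nbij' Ψ Ψ (fun p hp => (hspec p hp).1) (fun p hp => (hspec p hp).1)
      (fun p hp => (hspec p hp).2) (fun p hp => (hspec p hp).2) fun _ _ => rfl
  rw [Finset.sum_product, Finset.sum_product] at h1
  have h2 : ∑ _σ ∈ ordersFrom X, ∑ θ : Order U, F θ = (ordersFrom X).card * ∑ θ, F θ := by
    rw [Finset.sum_const, nsmul_eq_mul]
  exact h1.trans h2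

end Orders

/-! ### Expectations -/

section Expectation

variable {U D : Type} [Fintype U] [DecidableEq U]

/-- There are finitely many possible outputs, and each occurs on a measurable set of seeds, so an
arbitrary objective is a finite sum of indicators. -/
theorem OnlineAlg.measurable_comp_output (A : OnlineAlg U D) (Φ : Finset U → ℝ) (σ : Order U)
    (d : U → D) : Measurable fun ω => Φ (A.output ω σ d) := by
  classical
  have h (S : Finset U) : MeasurableSet {ω | A.output ω σ d = S} := by
    have := measurable_picked A.accept A.measurable_accept (fullHistory σ d)
      (fun l => decide ((l.map Prod.fst).toFinset = S)) (measurableSet_singleton true)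
    simpa [Set.preimage, OnlineAlg.output] using this
  have heq : (fun ω => Φ (A.output ω σ d)) =
      fun ω => ∑ S : Finset U, {ω | A.output ω σ d = S}.indicator (fun _ => Φ S) ω := by
    funext ω
    rw [Finset.sum_eq_single (A.output ω σ d)]
    · simp
    · intro S _ hS
      exact Set.indicator_of_notMem (fun h => hS h.symm) _
    · simp
  rw [heq]
  exact Finset.measurable_sum _ fun S _ => measurable_const.indicator (h S)

theorem norm_apply_le_sum {U : Type} [Fintype U] (Φ : Finset U → ℝ) (S : Finset U) :
    ‖Φ S‖ ≤ ∑ T : Finset U, ‖Φ T‖ :=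
  Finset.single_le_sum (f := fun T => ‖Φ T‖) (fun _ _ => norm_nonneg _) (Finset.mem_univ S)

theorem OnlineAlg.integrable_comp_output (A : OnlineAlg U D) (Φ : Finset U → ℝ) (σ : Order U)
    (d : U → D) : Integrable (fun ω => Φ (A.output ω σ d)) A.μ :=
  Integrable.of_bound (A.measurable_comp_output Φ σ d).aestronglyMeasurable _
    (Filter.Eventually.of_forall fun _ => norm_apply_le_sum Φ _)

/-- The average of a function of the coins for a fixed length of the sample. -/
def coinAverage (f : Coins U → ℝ) (k : ℕ) : ℝ :=
  (∑ a : Bool, ∑ b : Bool, ∑ θ : Order U, f (k, a, b, θ)) / (4 * Fintype.card (Order U))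

theorem integral_coinLaw (f : Coins U → ℝ) {B : ℝ} (hB : ∀ c, ‖f c‖ ≤ B) :
    ∫ c, f c ∂coinLaw U = (∑ k ∈ Finset.Iic (Fintype.card U),
      ((Fintype.card U).choose k : ℝ) * coinAverage f k) / 2 ^ Fintype.card U := by
  have hint {α : Type} [MeasurableSpace α] [Countable α] [MeasurableSingletonClass α]
      (μ : Measure α) [IsProbabilityMeasure μ] (g : α → ℝ) (hg : ∀ c, ‖g c‖ ≤ B) :
      Integrable g μ :=
    Integrable.of_bound (measurable_of_countable g).aestronglyMeasurable B
      (Filter.Eventually.of_forall hg)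
  rw [coinLaw, integral_prod f (hint _ f hB), ProbabilityTheory.integral_binomial,
    Finset.sum_div]
  refine Finset.sum_congr rfl fun k hk => ?_
  have hk' : k ≤ Fintype.card U := Finset.mem_Iic.1 hk
  have hinner : ∫ y, f (k, y) ∂fairCoin.prod (fairCoin.prod (randomOrder U)) =
      coinAverage f k := by
    rw [integral_prod (fun y => f (k, y)) (hint _ _ fun c => hB _), fairCoin, PMF.integral_eq_sum]
    have h2 (a : Bool) : ∫ y, f (k, a, y) ∂((PMF.uniformOfFintype Bool).toMeasure).prod
        (randomOrder U) = (∑ b : Bool, ∑ θ : Order U, f (k, a, b, θ)) /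
          (2 * Fintype.card (Order U)) := by
      rw [integral_prod (fun y => f (k, a, y)) (hint _ _ fun c => hB _), randomOrder,
        PMF.integral_eq_sum, Finset.sum_div]
      refine Finset.sum_congr rfl fun b _ => ?_
      rw [PMF.integral_eq_sum]
      simp only [PMF.uniformOfFintype_apply, smul_eq_mul, ENNReal.toReal_inv,
        ENNReal.toReal_natCast, Fintype.card_bool, ← Finset.mul_sum]
      rw [div_eq_mul_inv, mul_inv]
      push_cast
      ring
    simp only [h2, PMF.uniformOfFintype_apply, smul_eq_mul, ENNReal.toReal_inv,
      ENNReal.toReal_natCast, Fintype.card_bool, ← Finset.mul_sum, ← Finset.sum_div, coinAverage]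
    rw [div_eq_mul_inv, div_eq_mul_inv, mul_inv, mul_inv]
    push_cast
    ring
  rw [hinner, smul_eq_mul]
  -- At parameter 1/2 the weight apart from the binomial coefficient does not depend on `k`.
  have hpow : (1 / 2 : ℝ) ^ k * (1 - 1 / 2) ^ (Fintype.card U - k) =
      1 / 2 ^ Fintype.card U := by
    rw [show (1 - 1 / 2 : ℝ) = 1 / 2 by norm_num, ← pow_add, Nat.add_sub_cancel' hk', one_div_pow]
  change _ * (1 / 2 : ℝ) ^ k * (1 - 1 / 2) ^ (Fintype.card U - k) * _ = _
  rw [mul_assoc (_ : ℝ) ((1 / 2 : ℝ) ^ k), hpow]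
  ring

/-- The expected objective value for fixed coins and a fixed order. -/
def meanProfit (C : ℕ → ℕ) (M : Matroid U) (A : OnlineAlg U ℝ) (d : U → Request) (σ : Order U)
    (c : Coins U) : ℝ :=
  ∫ ω, profit C d ((profitAlg C M A).output (c, ω) σ d) ∂A.μ

theorem expected_profitAlg (C : ℕ → ℕ) (M : Matroid U) (A : OnlineAlg U ℝ) (d : U → Request) :
    (profitAlg C M A).expected (profit C d) d = (∑ σ, ∑ k ∈ Finset.Iic (Fintype.card U),
      ((Fintype.card U).choose k : ℝ) * coinAverage (meanProfit C M A d σ) k) /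
        (2 ^ Fintype.card U * Fintype.card (Order U)) := by
  rw [OnlineAlg.expected, div_mul_eq_div_div]
  congr 1
  rw [Finset.sum_div]
  refine Finset.sum_congr rfl fun σ _ => ?_
  have hint := (profitAlg C M A).integrable_comp_output (profit C d) σ d
  have h1 : ∫ ω, profit C d ((profitAlg C M A).output ω σ d) ∂(profitAlg C M A).μ =
      ∫ c, meanProfit C M A d σ c ∂coinLaw U :=
    integral_prod (μ := coinLaw U) (ν := A.μ)
      (fun ω => profit C d ((profitAlg C M A).output ω σ d)) hint
  rw [h1]
  refine integral_coinLaw _ (B := ∑ T : Finset U, ‖profit C d T‖) fun c => ?_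
  refine (norm_integral_le_of_norm_le_const
    (Filter.Eventually.of_forall fun ω => norm_apply_le_sum (profit C d) _)).trans ?_
  simp

end Expectation

/-! ### The competitive ratio -/

section Competitive

variable {U : Type} [Fintype U] {C : ℕ → ℕ} {M : Matroid U} {d : U → Request}

open scoped Classical in
/-- The whole requests. -/
def wholeSet (C : ℕ → ℕ) (d : U → Request) : Finset U :=
  Finset.univ.filter fun e => (d e).Whole C

theorem mem_wholeSet {e : U} : e ∈ wholeSet C d ↔ (d e).Whole C := by
  simp [wholeSet]

theorem reverse_ofFn_eq (σ : Order U) (k : ℕ) :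
    (List.ofFn σ).reverse = ((List.ofFn σ).drop k).reverse ++ ((List.ofFn σ).take k).reverse := by
  rw [← List.reverse_append, List.take_append_drop]

theorem length_reverse_take (σ : Order U) {k : ℕ} (hk : k ≤ Fintype.card U) :
    ((List.ofFn σ).take k).reverse.length = k := by
  simpa using hk

variable [DecidableEq U] {A : OnlineAlg U ℝ} {α : ℝ}

theorem filter_whole_eq (C : ℕ → ℕ) (d : U → Request) (X : Finset U) :
    (open scoped Classical in X.filter fun e => (d e).Whole C) = X ∩ wholeSet C d := by
  ext e
  simp [mem_wholeSet]

theorem mem_densityPrefix_compl {τ : ℝ} {X : Finset U} {e : U} :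
    e ∈ densityPrefix d τ (Xᶜ ∩ wholeSet C d) ↔ e ∉ X ∧ Eligible C τ (d e) := by
  rw [mem_densityPrefix, Finset.mem_inter, Finset.mem_compl, mem_wholeSet, and_assoc]
  rfl

theorem subroutineValue_nonneg (C : ℕ → ℕ) (τ : ℝ) (b : Bool) (r : Request) :
    0 ≤ subroutineValue C τ b r := by
  rw [subroutineValue]
  split_ifs with h
  · exact mul_nonneg (sub_nonneg.2 h.2) (Nat.cast_nonneg _)
  · exact Nat.cast_nonneg _
  · exact le_rfl

theorem streamValue_nonneg {U : Type} [DecidableEq U] (C : ℕ → ℕ) (d : U → Request) (τ : ℝ)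
    (b : Bool) (X : Finset U) (e : U) :
    0 ≤ streamValue C d τ b X e := by
  rw [streamValue]
  split_ifs
  · exact le_rfl
  · exact subroutineValue_nonneg _ _ _ _

theorem sum_streamValue (C : ℕ → ℕ) (d : U → Request) (τ : ℝ) (b : Bool) (X T : Finset U) :
    ∑ e ∈ T, streamValue C d τ b X e =
      ∑ e ∈ T ∩ densityPrefix d τ (Xᶜ ∩ wholeSet C d), subroutineValue C τ b (d e) := by
  rw [← Finset.filter_mem_eq_inter, Finset.sum_filter]
  refine Finset.sum_congr rfl fun e _ => ?_
  rw [streamValue]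
  by_cases hX : e ∈ X
  · rw [if_pos hX, if_neg fun h => (mem_densityPrefix_compl.1 h).1 hX]
  · by_cases hel : Eligible C τ (d e)
    · rw [if_neg hX, if_pos (mem_densityPrefix_compl.2 ⟨hX, hel⟩)]
    · rw [if_neg hX, if_neg fun h => hel (mem_densityPrefix_compl.1 h).2, subroutineValue,
        if_neg hel]

theorem sum_subroutineValue_true {τ : ℝ} {X T : Finset U}
    (hT : T ⊆ densityPrefix d τ (Xᶜ ∩ wholeSet C d)) :
    ∑ e ∈ T, subroutineValue C τ true (d e) = shiftedDensity d τ T :=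
  Finset.sum_congr rfl fun e he => by
    rw [subroutineValue, if_pos (mem_densityPrefix_compl.1 (hT he)).2, if_pos rfl]

theorem sum_subroutineValue_false {τ : ℝ} {X T : Finset U}
    (hT : T ⊆ densityPrefix d τ (Xᶜ ∩ wholeSet C d)) :
    ∑ e ∈ T, subroutineValue C τ false (d e) = totalSize d T := by
  rw [totalSize, Nat.cast_sum]
  exact Finset.sum_congr rfl fun e he => by
    rw [subroutineValue, if_pos (mem_densityPrefix_compl.1 (hT he)).2, if_neg Bool.false_ne_true]

theorem output_profitAlg (c : Coins U) (ω : A.Ω) (σ : Order U) :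
    (profitAlg C M A).output (c, ω) σ d =
      ((picked (profitAccept C M (A.accept ω) c)
        (history d (List.ofFn σ).reverse)).map Prod.fst).toFinset :=
  congrArg (fun h => ((picked (profitAccept C M (A.accept ω) c) h).map Prod.fst).toFinset)
    (fullHistory_eq σ d)

theorem toFinset_reverse_take {X : Finset U} {σ : Order U} (hσ : σ ∈ ordersFrom X) :
    ((List.ofFn σ).take X.card).reverse.toFinset = X := by
  rw [List.toFinset_reverse]
  exact mem_ordersFrom.1 hσ

theorem mem_reverse_drop_iff {X : Finset U} {σ : Order U} (hσ : σ ∈ ordersFrom X) (x : U) :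
    x ∈ ((List.ofFn σ).drop X.card).reverse ↔ x ∉ X := by
  rw [List.mem_reverse, mem_drop_iff hσ]

theorem output_of_heads {X : Finset U} {σ : Order U} (hσ : σ ∈ ordersFrom X) (b : Bool)
    (θ : Order U) (ω : A.Ω) :
    (profitAlg C M A).output ((X.card, true, b, θ), ω) σ d = ∅ ∨
      ∃ e, Beats C M d X e ∧ (profitAlg C M A).output ((X.card, true, b, θ), ω) σ d = {e} := by
  rw [output_profitAlg, reverse_ofFn_eq σ X.card]
  refine (picked_of_heads (length_reverse_take σ X.card_le_univ) rfl).imp_right ?_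
  rintro ⟨e, -, hb, h⟩
  rw [toFinset_reverse_take hσ] at hb
  exact ⟨e, hb, h⟩

theorem output_of_heads_eq {X : Finset U} {σ : Order U} (hσ : σ ∈ ordersFrom X) (b : Bool)
    (θ : Order U) (ω : A.Ω) {e : U} (he : e ∉ X) (hb : Beats C M d X e)
    (hunique : ∀ y ∉ X, Beats C M d X y → y = e) :
    (profitAlg C M A).output ((X.card, true, b, θ), ω) σ d = {e} := by
  rw [output_profitAlg, reverse_ofFn_eq σ X.card]
  refine picked_of_heads_eq (length_reverse_take σ X.card_le_univ) rfl
    ((mem_reverse_drop_iff hσ e).2 he) (by rwa [toFinset_reverse_take hσ]) fun y hy hby => ?_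
  rw [toFinset_reverse_take hσ] at hby
  exact hunique y ((mem_reverse_drop_iff hσ y).1 hy) hby

theorem output_of_tails_none {X : Finset U} {σ : Order U} (hσ : σ ∈ ordersFrom X) (b : Bool)
    (θ : Order U) (ω : A.Ω) (hτ : threshold C M d (X ∩ wholeSet C d) = none) :
    (profitAlg C M A).output ((X.card, false, b, θ), ω) σ d = ∅ := by
  rw [output_profitAlg, reverse_ofFn_eq σ X.card]
  refine picked_of_tails_none (length_reverse_take σ X.card_le_univ) rfl ?_
  rw [toFinset_reverse_take hσ, filter_whole_eq, hτ]

/-- This ties the online run to a run of the subroutine on a complete order of the whole ground set,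
where its guarantee is available. The list records the order in which the filter sees the selected
elements. -/
theorem output_of_tails {X : Finset U} {σ : Order U} (hσ : σ ∈ ordersFrom X) (b : Bool)
    (θ : Order U) (ω : A.Ω) {τ : ℝ} (hτ : threshold C M d (X ∩ wholeSet C d) = some τ) :
    ∃ l : List U, l.Nodup ∧
      l.toFinset = A.output ω (θ.trans (align X σ θ)) (streamValue C d τ b X) ∩
        densityPrefix d τ (Xᶜ ∩ wholeSet C d) ∧
      (profitAlg C M A).output ((X.card, false, b, θ), ω) σ d = kept C d l := by
  obtain ⟨hg, hθ⟩ := align_spec hσ θ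
  refine ⟨(picked (inSubroutine C τ b (A.accept ω) (List.ofFn θ) X)
    (history d ((List.ofFn σ).drop X.card).reverse)).map Prod.fst, ?_, ?_, ?_⟩
  · exact (List.nodup_reverse.2 ((nodup_ofFn_order σ).sublist (List.drop_sublist _ _))).sublist
      (map_fst_picked_sublist _ d _)
  · ext e
    rw [List.mem_toFinset, mem_picked_inSubroutine C d τ b A ω X θ (align X σ θ) hg
      (mem_reverse_drop_iff hσ) (by rw [List.reverse_reverse, hθ]), Finset.mem_inter,
      mem_densityPrefix_compl]
  · rw [output_profitAlg, reverse_ofFn_eq σ X.card]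
    have h := picked_of_tails (C := C) (M := M) (d := d) (acc := A.accept ω)
      (c := (X.card, false, b, θ)) (R := ((List.ofFn σ).drop X.card).reverse)
      (length_reverse_take σ X.card_le_univ) rfl (τ := τ)
      (by rw [toFinset_reverse_take hσ, filter_whole_eq, hτ])
    rw [toFinset_reverse_take hσ] at h
    exact h

variable (hC : IsCost C) (hd : IsInstance d)
  (hA : A.IsCompetitive {w | ∀ e, 0 ≤ w e} (fun S => M.Indep (S : Set U))
    (fun w S => ∑ e ∈ S, w e) α)

include hC hA in
-- Besides feasibility, this gives a nonnegative profit in every outcome, so unfavourable samples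
-- and coins can be discarded in lower bounds.
theorem output_spec (ω : (profitAlg C M A).Ω) (σ : Order U) :
    M.Indep ((profitAlg C M A).output ω σ d : Set U) ∧
      0 ≤ profit C d ((profitAlg C M A).output ω σ d) := by
  obtain ⟨⟨k, a, b, θ⟩, ω⟩ := ω
  have hempty (h : (profitAlg C M A).output ((k, a, b, θ), ω) σ d = ∅) :
      M.Indep ((profitAlg C M A).output ((k, a, b, θ), ω) σ d : Set U) ∧
      0 ≤ profit C d ((profitAlg C M A).output ((k, a, b, θ), ω) σ d) := by
    rw [h, profit_empty hC]
    simp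
  -- Feasibility is required for every seed, including sample lengths that have probability 0; with
  -- those, everything is rejected.
  rcases lt_or_ge (Fintype.card U) k with hk | hk
  · refine hempty ?_
    rw [output_profitAlg, picked_profitAccept_of_le (by simpa using hk.le)]
    rfl
  obtain ⟨X, hσ, rfl⟩ : ∃ X : Finset U, σ ∈ ordersFrom X ∧ X.card = k := by
    have hX : ((List.ofFn σ).take k).toFinset.card = k := by
      rw [List.toFinset_card_of_nodup ((nodup_ofFn_order σ).sublist (List.take_sublist _ _))]
      simpa using hk
    exact ⟨_, mem_ordersFrom.2 (by rw [hX]), hX⟩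
  cases a
  · cases hτ : threshold C M d (X ∩ wholeSet C d) with
    | none => exact hempty (output_of_tails_none hσ b θ ω hτ)
    | some τ =>
      obtain ⟨l, -, hl, h⟩ := output_of_tails hσ b θ ω hτ
      rw [h]
      refine ⟨?_, profit_kept_nonneg hC d l⟩
      refine ((hA (streamValue C d τ b X) (streamValue_nonneg C d τ b X)).1 ω
        (θ.trans (align X σ θ))).subset ?_
      exact_mod_cast (kept_subset C d l).trans (hl ▸ Finset.inter_subset_left)
  · rcases output_of_heads hσ b θ ω with h | ⟨e, hb, h⟩
    · exact hempty h
    · rw [h]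
      exact ⟨by simpa using hb.1, hb.2.1.le⟩

include hC hA in
theorem meanProfit_nonneg (σ : Order U) (c : Coins U) : 0 ≤ meanProfit C M A d σ c :=
  integral_nonneg fun ω => (output_spec hC hA (c, ω) σ).2

include hC hA in
theorem coinAverage_meanProfit_ge (σ : Order U) (k : ℕ) (a : Bool) :
    (∑ b : Bool, ∑ θ : Order U, meanProfit C M A d σ (k, a, b, θ)) /
      (4 * Fintype.card (Order U)) ≤ coinAverage (meanProfit C M A d σ) k := by
  refine div_le_div_of_nonneg_right ?_ (by positivity)
  exact Finset.single_le_sum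
    (f := fun a => ∑ b : Bool, ∑ θ : Order U, meanProfit C M A d σ (k, a, b, θ))
    (fun a _ => Finset.sum_nonneg fun b _ => Finset.sum_nonneg fun θ _ =>
      meanProfit_nonneg hC hA σ _) (Finset.mem_univ a)

include hC hA in
theorem expected_nonneg : 0 ≤ (profitAlg C M A).expected (profit C d) d :=
  div_nonneg (Finset.sum_nonneg fun σ _ => integral_nonneg fun ω => (output_spec hC hA ω σ).2)
    (Nat.cast_nonneg _)

include hC hA in
-- All samples are equally likely and profits are nonnegative, so it suffices to bound the
-- contribution of the samples in `G` with first coin `a`. The factor 4 accounts for the two coins,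
-- so `v` already includes the probability of `a`.
theorem card_mul_le_expected (G : Finset (Finset U)) (a : Bool) (v : ℝ)
    (h : ∀ X ∈ G, (4 * Fintype.card (Order U) : ℝ) * ((ordersFrom X).card * v) ≤
      ∑ b : Bool, ∑ σ ∈ ordersFrom X, ∑ θ : Order U,
        meanProfit C M A d σ (X.card, a, b, θ)) :
    G.card * v ≤ 2 ^ Fintype.card U * (profitAlg C M A).expected (profit C d) d := by
  have hcard : (0 : ℝ) < Fintype.card (Order U) := by exact_mod_cast Fintype.card_pos
  have h1 := sum_le_sum_binomial (fun X => if X ∈ G then v else 0)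
    (fun k σ => coinAverage (meanProfit C M A d σ) k) fun X => by
      split_ifs with hX
      · refine le_trans ?_ (Finset.sum_le_sum fun σ _ =>
          coinAverage_meanProfit_ge hC hA σ X.card a)
        rw [← Finset.sum_div, Finset.sum_comm, le_div_iff₀ (by positivity), mul_comm]
        exact h X hX
      · rw [mul_zero]
        refine Finset.sum_nonneg fun σ _ => div_nonneg ?_ (by positivity)
        exact Finset.sum_nonneg fun _ _ => Finset.sum_nonneg fun _ _ =>
          Finset.sum_nonneg fun _ _ => meanProfit_nonneg hC hA σ _
  rw [Finset.sum_ite_mem, Finset.univ_inter, Finset.sum_const, nsmul_eq_mul] at h1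
  rw [expected_profitAlg, ← mul_div_assoc, mul_div_mul_left _ _ (by positivity),
    le_div_iff₀ hcard, mul_comm]
  exact h1

include hC hd hA in
/-- The most profitable single element is not much more profitable than the algorithm. -/
theorem exists_single_bound : ∃ m, 0 ≤ m ∧ (∀ e, M.Indep {e} → profit C d {e} ≤ m) ∧
    m ≤ 8 * (profitAlg C M A).expected (profit C d) d := by
  classical
  by_cases hpos : ∃ a, M.Indep {a} ∧ 0 < profit C d {a}
  · obtain ⟨a₀, ha₀, ha₀pos⟩ := hpos
    obtain ⟨a, ha, hmax⟩ := Finset.exists_max_image (Finset.univ.filter fun e => M.Indep {e})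
      (fun e => profit C d {e}) ⟨a₀, Finset.mem_filter.2 ⟨Finset.mem_univ _, ha₀⟩⟩
    have hmax' (e : U) (he : M.Indep {e}) : profit C d {e} ≤ profit C d {a} :=
      hmax e (Finset.mem_filter.2 ⟨Finset.mem_univ _, he⟩)
    have hapos := ha₀pos.trans_le (hmax' a₀ ha₀)
    refine ⟨profit C d {a}, hapos.le, hmax', ?_⟩
    obtain ⟨b, hab, G, hG, hGsep⟩ := exists_separating_samples hd (Finset.mem_filter.1 ha).2 hapos
    -- One half for the coin and one quarter for the samples give the constant 8.
    have h1 := card_mul_le_expected (d := d) hC hA G true (profit C d {b} / 2) fun X hX => by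
      obtain ⟨hbX, hbeats, hunique⟩ := hGsep X hX
      have hmean (σ : Order U) (hσ : σ ∈ ordersFrom X) (c : Bool) (θ : Order U) :
          meanProfit C M A d σ (X.card, true, c, θ) = profit C d {b} := by
        simp only [meanProfit, output_of_heads_eq hσ c θ _ hbX hbeats hunique]
        simp
      rw [Fintype.sum_bool, Finset.sum_congr rfl fun σ hσ => Finset.sum_congr rfl fun θ _ =>
        hmean σ hσ true θ, Finset.sum_congr rfl fun σ hσ => Finset.sum_congr rfl fun θ _ =>
        hmean σ hσ false θ]
      simp only [Finset.sum_const, nsmul_eq_mul, Finset.card_univ]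
      exact le_of_eq (by ring)
    have h2 : (2 : ℝ) ^ Fintype.card U ≤ 4 * G.card := by exact_mod_cast hG
    have h3 : (0 : ℝ) < 2 ^ Fintype.card U := by positivity
    have h4 : (2 : ℝ) ^ Fintype.card U * profit C d {b} ≤ 4 * G.card * profit C d {b} :=
      mul_le_mul_of_nonneg_right h2 (hapos.le.trans hab)
    refine hab.trans (le_of_mul_le_mul_left ?_ h3)
    linarith
  · push Not at hpos
    exact ⟨0, le_rfl, hpos, by linarith [expected_nonneg (d := d) hC hA]⟩

include hA in
/-- If what is kept is bounded below by a multiple of the value of the result of the subroutine,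
then the subroutine can be replaced by any feasible set. -/
theorem le_sum_meanProfit {X : Finset U} {τ : ℝ} (b : Bool)
    (hτ : threshold C M d (X ∩ wholeSet C d) = some τ) (hα : 0 < α) {c : ℝ} (hc : 0 ≤ c)
    (hkept : ∀ l : List U, l.Nodup → l.toFinset ⊆ densityPrefix d τ (Xᶜ ∩ wholeSet C d) →
      M.Indep (l.toFinset : Set U) →
      c * ∑ e ∈ l.toFinset, subroutineValue C τ b (d e) ≤ profit C d (kept C d l))
    {S : Finset U} (hSP : S ⊆ densityPrefix d τ (Xᶜ ∩ wholeSet C d)) (hS : M.Indep (S : Set U)) :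
    (Fintype.card (Order U) : ℝ) * ((ordersFrom X).card *
        (c * ∑ e ∈ S, subroutineValue C τ b (d e))) ≤
      α * ∑ σ ∈ ordersFrom X, ∑ θ : Order U, meanProfit C M A d σ (X.card, false, b, θ) := by
  set w := streamValue C d τ b X with hw
  obtain ⟨hind, hcomp⟩ := hA w (streamValue_nonneg C d τ b X)
  set F : Order U → ℝ := fun θ => ∫ ω, ∑ e ∈ A.output ω θ w, w e ∂A.μ with hF
  have h1 : ∀ σ ∈ ordersFrom X, ∀ θ : Order U, c * F (θ.trans (align X σ θ)) ≤
      meanProfit C M A d σ (X.card, false, b, θ) := by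
    intro σ hσ θ
    rw [hF, meanProfit, ← integral_const_mul]
    refine integral_mono_of_nonneg ?_ ?_ ?_
    · exact Filter.Eventually.of_forall fun ω => mul_nonneg hc
        (Finset.sum_nonneg fun e _ => streamValue_nonneg C d τ b X e)
    · have hmeas := ((profitAlg C M A).measurable_comp_output (profit C d) σ d).comp
        (measurable_prodMk_left (x := ((X.card, false, b, θ) : Coins U)))
      exact Integrable.of_bound hmeas.aestronglyMeasurable _
        (Filter.Eventually.of_forall fun ω => norm_apply_le_sum (profit C d) _)
    · refine Filter.Eventually.of_forall fun ω => ?_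
      obtain ⟨l, hnd, hl, hout⟩ := output_of_tails (M := M) (A := A) hσ b θ ω hτ
      have h2 := hkept l hnd (hl ▸ Finset.inter_subset_right)
        ((hind ω (θ.trans (align X σ θ))).subset (by
          rw [hl]
          exact_mod_cast Finset.inter_subset_left))
      rw [hl, ← sum_streamValue] at h2
      simpa only [hout] using h2
  -- Averaged over the arrival order and the simulated order, the aligned stream is uniform, so the
  -- subroutine's expected value appears here in full.
  have h2 : c * ((ordersFrom X).card * ∑ θ, F θ) ≤
      ∑ σ ∈ ordersFrom X, ∑ θ : Order U, meanProfit C M A d σ (X.card, false, b, θ) := by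
    rw [← sum_align X F, Finset.mul_sum]
    refine Finset.sum_le_sum fun σ hσ => ?_
    rw [Finset.mul_sum]
    exact Finset.sum_le_sum fun θ _ => h1 σ hσ θ
  have h3 := hcomp S hS
  have hcard : (0 : ℝ) < Fintype.card (Order U) := by exact_mod_cast Fintype.card_pos
  rw [OnlineAlg.expected, ← mul_div_assoc, le_div_iff₀ hcard] at h3
  simp only [hw, sum_streamValue, Finset.inter_eq_left.2 hSP] at h3
  have h4 : (ordersFrom X).card * c * ((∑ e ∈ S, subroutineValue C τ b (d e)) *
      Fintype.card (Order U)) ≤ (ordersFrom X).card * c * (α * ∑ θ, F θ) := by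
    refine mul_le_mul_of_nonneg_left (h3.trans_eq ?_) (by positivity)
    simp only [hF, hw, sum_streamValue]
  have h5 := mul_le_mul_of_nonneg_left h2 hα.le
  linarith

include hC hd hA in
/-- Without very profitable single elements, the algorithm is competitive on the whole requests. -/
theorem maxProfit_whole_le_expected (hα : 1 ≤ α) {m : ℝ} (hm0 : 0 ≤ m)
    (hm : ∀ e, M.Indep {e} → profit C d {e} ≤ m)
    (hmV : 34560 * m ≤ maxProfit C M d (wholeSet C d))
    (hV : 0 < maxProfit C M d (wholeSet C d)) :
    maxProfit C M d (wholeSet C d) ≤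
      276480 * α * (profitAlg C M A).expected (profit C d) d := by
  set V := maxProfit C M d (wholeSet C d) with hVdef
  have hα0 : 0 < α := by linarith
  obtain ⟨G, hG, hGgood⟩ := exists_good_samples (M := M) (d := d) hC (wholeSet C d) hm0
    (fun e _ => hm e) (by linarith) hV
  have h1 := card_mul_le_expected (d := d) hC hA G false (V / (4 * 34560 * α)) fun X hX => by
    obtain ⟨hX1, hX2⟩ := hGgood X hX
    have hwhole : ∀ e ∈ X ∩ wholeSet C d, (d e).Whole C := fun e he =>
      mem_wholeSet.1 (Finset.mem_inter.1 he).2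
    have hne : (X ∩ wholeSet C d).Nonempty := by
      rw [Finset.nonempty_iff_ne_empty]
      intro h
      obtain ⟨S, hS, -, hSpi⟩ := exists_profit_eq_maxProfit C M d (X ∩ wholeSet C d)
      rw [h, Finset.subset_empty] at hS
      rw [← hSpi, hS, profit_empty hC] at hX1
      linarith
    obtain ⟨τ, hτ, hτ0, hτ1, hτ2⟩ := threshold_spec (M := M) hC hd hwhole hne
    obtain ⟨x, hx⟩ := exists_le_surplus hC hd M (X ∩ wholeSet C d) τ
    -- The sample prefix is worth a fraction 1/480 of a sample worth `V / 6`: hence 2880 = 6 · 480.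
    have hP := hX2 τ (by linarith)
    set P := densityPrefix d τ (Xᶜ ∩ wholeSet C d) with hPdef
    obtain ⟨S₁, hS₁P, hS₁, S₂, hS₂P, hS₂, c₁, hc₁, c₂, hc₂, hkept, hsum⟩ :=
      exists_kept_bounds (M := M) hC hd hτ0 hm0 (P := P)
        (fun e he => (mem_densityPrefix_compl.1 he).2) (fun e _ => hm e) x
    have hb₁ := le_sum_meanProfit hA true hτ hα0 hc₁ (fun l hl hlP hli => by
      rw [sum_subroutineValue_true hlP]
      exact (hkept l hl hlP hli).1) hS₁P hS₁
    have hb₂ := le_sum_meanProfit hA false hτ hα0 hc₂ (fun l hl hlP hli => by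
      rw [sum_subroutineValue_false hlP]
      exact (hkept l hl hlP hli).2) hS₂P hS₂
    rw [sum_subroutineValue_true hS₁P] at hb₁
    rw [sum_subroutineValue_false hS₂P] at hb₂
    -- The remaining prefix is worth `V / 17280`, of which at most half, `V / 34560`, is lost to
    -- `m`. The surplus at `x` is at least 157/160 of the sample optimum, hence far larger.
    have hv : V / 34560 ≤ c₁ * shiftedDensity d τ S₁ + c₂ * totalSize d S₂ := by
      refine le_trans ?_ hsum
      rw [le_sub_iff_add_le]
      exact le_min (by linarith) (by linarith)
    have hmul := mul_le_mul_of_nonneg_left hv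
      (show (0 : ℝ) ≤ Fintype.card (Order U) * (ordersFrom X).card by positivity)
    rw [Fintype.sum_bool]
    refine le_of_mul_le_mul_left ?_ hα0
    have heq : α * ((4 * Fintype.card (Order U) : ℝ) *
        ((ordersFrom X).card * (V / (4 * 34560 * α)))) =
        Fintype.card (Order U) * (ordersFrom X).card * (V / 34560) := by
      field_simp
    rw [heq]
    linarith
  have h2 : (2 : ℝ) ^ Fintype.card U ≤ 2 * G.card := by exact_mod_cast hG
  -- Two coins and half of the samples give 276480 = 4 · 2 · 34560.
  have h3 : (0 : ℝ) < 2 ^ Fintype.card U := by positivity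
  have hq : 0 ≤ V / (4 * 34560 * α) := by positivity
  have h4 := mul_le_mul_of_nonneg_right h2 hq
  have h5 : V / (4 * 34560 * α) ≤ 2 * (profitAlg C M A).expected (profit C d) d := by
    refine le_of_mul_le_mul_left ?_ h3
    linarith
  rw [div_le_iff₀ (by positivity)] at h5
  linarith

end Competitive

end OnlineSelection

end

theorem theorem3 :
    ∃ K : ℝ, 0 < K ∧
      ∀ (U : Type) [Fintype U] [DecidableEq U]
        (M : Matroid U) (_ : M.E = Set.univ)
        (C : ℕ → ℕ) (_ : OnlineSelection.IsCost C)
        (α : ℝ) (_ : 1 ≤ α)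
        (A : OnlineSelection.OnlineAlg U ℝ)
        (_ : A.IsCompetitive {w | ∀ e, 0 ≤ w e} (fun S => M.Indep (S : Set U))
          (fun w S => ∑ e ∈ S, w e) α),
        (OnlineSelection.profitAlg C M A).IsCompetitive
          {d | OnlineSelection.IsInstance d} (fun S => M.Indep (S : Set U))
          (fun d S => OnlineSelection.profit C d S) (K * α) := by
  -- Twice 276480. The slack absorbs `m`, which is at most 8 times the expected profit, and the case
  -- `V < 34560 * m`, where the optimum is at most 34561 · 8 times the expected profit.
  refine ⟨552960, by norm_num, ?_⟩
  intro U _ _ M _ C hC α hα A hA d hd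
  refine ⟨fun ω σ => (OnlineSelection.output_spec hC hA ω σ).1, fun S hS => ?_⟩
  obtain ⟨m, hm0, hm, hmE⟩ := OnlineSelection.exists_single_bound hC hd hA
  have hE0 := OnlineSelection.expected_nonneg (d := d) hC hA
  have h1 := OnlineSelection.profit_le_maxProfit (C := C) (d := d) hS (Finset.subset_univ S)
  have h2 := OnlineSelection.profit_le_maxProfit_whole_add (M := M) hC hd
    (T := Finset.univ) (W := OnlineSelection.wholeSet C d)
    (fun e _ he => OnlineSelection.mem_wholeSet.2 he) hm0 (fun e _ => hm e)
  have h3 := OnlineSelection.maxProfit_whole_le_expected (d := d) hC hd hA hα hm0 hm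
  have h4 := OnlineSelection.maxProfit_nonneg hC M d (OnlineSelection.wholeSet C d)
  change OnlineSelection.profit C d S ≤
    552960 * α * (OnlineSelection.profitAlg C M A).expected (OnlineSelection.profit C d) d
  set E := (OnlineSelection.profitAlg C M A).expected (OnlineSelection.profit C d) d with hE
  have hαE : E ≤ α * E := le_mul_of_one_le_left hE0 hα
  rcases lt_or_ge (OnlineSelection.maxProfit C M d (OnlineSelection.wholeSet C d)) (34560 * m)
    with hlt | hge
  · linarith
  · rcases h4.eq_or_lt with h0 | hpos
    · linarith
    · linarith [h3 hge hpos]
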